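/- Let $n\ge 3$, $m\ge 1$, and let $g=\sum_{i}\varepsilon_i\,dx_i^2$ with $\varepsilon_i\in\{1,-1\}$ be a pseudo-Euclidean metric on $\mathbb{R}^n$, so that $g_{ij}=\delta_{ij}\varepsilon_i$ in the coordinates $x=(x_1,\dots,x_n)$. Let $(F^m,g_F)$ be a non-empty $m$-dimensional semi-Riemannian manifold of constant scalar curvature $\lambda_F\in\mathbb{R}$. Let $f,\varphi,h:\mathbb{R}^n\to\mathbb{R}$ be smooth functions with $f>0$ everywhere and $\varphi$ nowhere zero, and let $\rho\in\mathbb{R}$. Put $\bar g=\varphi^{-2}g$ and let $M=(\mathbb{R}^n,\bar g)\times_f F^m$ be the warped product, that is, $\mathbb{R}^n\times F$ with the metric $\tilde g=\bar g\oplus f^2g_F$. Regard $h$ as the function $(x,y)\mapsto h(x)$ on $M$, and write $u_{,x_i}=\partial u/\partial x_i$ and $u_{,x_ix_j}=\partial^2u/\partial x_i\partial x_j$. Then $(M,\tilde g)$ is a gradient Yamabe soliton with potential function $h$ and constant $\rho$, that is, $$(S_{\tilde g}-\rho)\,\tilde g=\mathrm{Hess}_{\tilde g}(h)$$ on $M$,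 where $S_{\tilde g}$ is the scalar curvature of $\tilde g$, if and only if $f,\varphi,h$ satisfy the following equations at every point of $\mathbb{R}^n$: (1) for all $i\ne j$, $$h_{,x_ix_j}+\frac{\varphi_{,x_j}}{\varphi}h_{,x_i}+\frac{\varphi_{,x_i}}{\varphi}h_{,x_j}=0;$$ (2) for all $i$, $$\Big[(n-1)\Big(2\varphi\sum_k\varepsilon_k\varphi_{,x_kx_k}-n\sum_k\varepsilon_k\varphi_{,x_k}^2\Big)+\frac{\lambda_F}{f^2}-\frac{2m}{f}\Big(\varphi^2\sum_k\varepsilon_kf_{,x_kx_k}-(n-2)\varphi\sum_k\varepsilon_k\varphi_{,x_k}f_{,x_k}\Big)-\frac{m(m-1)}{f^2}\varphi^2\sum_k\varepsilon_kf_{,x_k}^2-\rho\Big]\frac{\varepsilon_i}{\varphi^2}$$ $$=h_{,x_ix_i}+2\frac{\varphi_{,x_i}}{\varphi}h_{,x_i}-\varepsilon_i\sum_k\varepsilon_k\frac{\varphi_{,x_k}}{\varphi}h_{,x_k};$$ (3) $$(n-1)\Big(2\varphi\sum_k\varepsilon_k\varphi_{,x_kx_k}-n\sum_k\varepsilon_k\varphi_{,x_k}^2\Big)+\frac{\lambda_F}{f^2}-\frac{2m}{f}\Big(\varphi^2\sum_k\varepsilon_kf_{,x_kx_k}-(n-2)\varphi\sum_k\varepsilon_k\varphi_{,x_k}f_{,x_k}\Big)-\frac{m(m-1)}{f^2}\varphi^2\sum_k\varepsilon_kf_{,x_k}^2-\rho=\frac{\varphi^2}{f}\sum_k\varepsilon_kf_{,x_k}h_{,x_k}.$$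 -/

import Mathlib

open scoped Manifold ContDiff

set_option maxSynthPendingDepth 3

noncomputable section

/-! ### Coordinate expressions of the classical tensors

`G : E → E →L[ℝ] E →L[ℝ] ℝ` is a metric written in a chart with values in the vector space `E`.
All formulas are the classical index formulas, written without choosing a basis of `E`. -/

namespace LocalGeometry

variable {E : Type*} [NormedAddCommGroup E] [NormedSpace ℝ E]

/-- Christoffel symbols of the first kind,
`(u, v, w) ↦ ½ (∂_u G(v, w) + ∂_v G(u, w) - ∂_w G(u, v))`. -/
def christoffelFirst (G : E → E →L[ℝ] E →L[ℝ] ℝ) (x : E) : E →L[ℝ] E →L[ℝ] E →L[ℝ] ℝ :=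
  let T : (E →L[ℝ] E →L[ℝ] ℝ) →L[ℝ] (E →L[ℝ] E →L[ℝ] ℝ) :=
    (ContinuousLinearMap.flipₗᵢ ℝ E E ℝ).toContinuousLinearEquiv
  (1 / 2 : ℝ) • (fderiv ℝ G x + (fderiv ℝ G x).flip - T ∘L (fderiv ℝ G x).flip)

theorem christoffelFirst_apply (G : E → E →L[ℝ] E →L[ℝ] ℝ) (x u v w : E) :
    christoffelFirst G x u v w =
      (1 / 2) * (fderiv ℝ G x u v w + fderiv ℝ G x v u w - fderiv ℝ G x w u v) := by
  simp [christoffelFirst]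

/-- Christoffel symbols `Γ(u, v)` of the Levi-Civita connection: the first index of the symbols
of the first kind is raised with the inverse of `G x`, regarded as an isomorphism `E → E*`. -/
def christoffel (G : E → E →L[ℝ] E →L[ℝ] ℝ) (x : E) : E →L[ℝ] E →L[ℝ] E :=
  (ContinuousLinearMap.compL ℝ E (E →L[ℝ] ℝ) E (G x).inverse) ∘L christoffelFirst G x

theorem christoffel_apply (G : E → E →L[ℝ] E →L[ℝ] ℝ) (x u v : E) :
    christoffel G x u v = (G x).inverse (christoffelFirst G x u v) := by
  simp [christoffel]

/-- Riemann curvature tensor `R(u, v) w = ∇_u ∇_v w - ∇_v ∇_u w` of the constant vector fields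
`u`, `v`, `w` of the chart, as a linear function of `u`. -/
def riemann (G : E → E →L[ℝ] E →L[ℝ] ℝ) (x v w : E) : E →ₗ[ℝ] E where
  toFun u :=
    fderiv ℝ (christoffel G) x u v w - fderiv ℝ (christoffel G) x v u w
      + christoffel G x u (christoffel G x v w) - christoffel G x v (christoffel G x u w)
  map_add' a b := by
    simp only [map_add, add_apply]
    abel
  map_smul' c a := by
    simp only [map_smul, smul_apply, RingHom.id_apply, smul_sub, smul_add]

/-- Ricci tensor `Ric(v, w) = tr (u ↦ R(u, v) w)`. -/
def ricci (G : E → E →L[ℝ] E →L[ℝ] ℝ) (x : E) : E →ₗ[ℝ] E →ₗ[ℝ] ℝ :=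
  LinearMap.mk₂ ℝ (fun v w => LinearMap.trace ℝ E (riemann G x v w))
    (fun v v' w => by
      rw [← map_add]; congr 1; ext u
      simp only [riemann, map_add, add_apply, LinearMap.add_apply, LinearMap.add_apply,
        LinearMap.coe_mk, AddHom.coe_mk]
      abel)
    (fun c v w => by
      rw [← map_smul]; congr 1; ext u
      simp only [riemann, map_smul, smul_apply, LinearMap.smul_apply,
        LinearMap.coe_mk, AddHom.coe_mk, smul_sub, smul_add])
    (fun v w w' => by
      rw [← map_add]; congr 1; ext u
      simp only [riemann, map_add, LinearMap.add_apply, LinearMap.coe_mk, AddHom.coe_mk]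
      abel)
    (fun c v w => by
      rw [← map_smul]; congr 1; ext u
      simp only [riemann, map_smul, LinearMap.smul_apply, LinearMap.coe_mk, AddHom.coe_mk,
        smul_sub, smul_add])

/-- Scalar curvature: the metric trace of the Ricci tensor, that is, the trace of the
endomorphism `v ↦ (G x)⁻¹ (Ric(v, ·))`. -/
def scalarCurvature [FiniteDimensional ℝ E] (G : E → E →L[ℝ] E →L[ℝ] ℝ) (x : E) : ℝ :=
  LinearMap.trace ℝ E
    ((G x).inverse.toLinearMap ∘ₗ LinearMap.toContinuousLinearMap.toLinearMap ∘ₗ ricci G x)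

/-- Hessian `Hess h (u, v) = u (v h) - (∇_u v) h` for constant vector fields `u`, `v`. -/
def hessian (G : E → E →L[ℝ] E →L[ℝ] ℝ) (h : E → ℝ) (x u v : E) : ℝ :=
  fderiv ℝ (fderiv ℝ h) x u v - fderiv ℝ h x (christoffel G x u v)

end LocalGeometry

/-! ### Semi-Riemannian manifolds -/

theorem contDiffOn_bilinearComp {X Y : Type*} [NormedAddCommGroup X] [NormedSpace ℝ X]
    [NormedAddCommGroup Y] [NormedSpace ℝ Y] {β : Y → X →L[ℝ] X →L[ℝ] ℝ} {s : Set Y}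
    (hβ : ContDiffOn ℝ ∞ β s) (π : Y →L[ℝ] X) :
    ContDiffOn ℝ ∞ (fun y => (β y).bilinearComp π π) s := by
  let L : (X →L[ℝ] X →L[ℝ] ℝ) →L[ℝ] (Y →L[ℝ] Y →L[ℝ] ℝ) :=
    ContinuousLinearMap.compL ℝ Y (X →L[ℝ] ℝ) (Y →L[ℝ] ℝ)
        ((ContinuousLinearMap.compL ℝ Y X ℝ).flip π)
      ∘L (ContinuousLinearMap.compL ℝ Y X (X →L[ℝ] ℝ)).flip π
  exact L.contDiff.comp_contDiffOn hβ

section Manifolds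

variable {E : Type*} [NormedAddCommGroup E] [NormedSpace ℝ E]
  {H : Type*} [TopologicalSpace H] (I : ModelWithCorners ℝ E H) [I.Boundaryless]
  {M : Type*} [TopologicalSpace M] [ChartedSpace H M]

/-- The expression of a field of bilinear forms `g` on `M` in the chart around `p`: the pullback
of `g` by the inverse of the chart. -/
def chartExpression
    (g : ∀ q : M, TangentSpace I q →L[ℝ] TangentSpace I q →L[ℝ] ℝ) (p : M) (y : E) :
    E →L[ℝ] E →L[ℝ] ℝ :=
  let D : E →L[ℝ] E := mfderiv 𝓘(ℝ, E) I (extChartAt I p).symm y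
  let B : E →L[ℝ] E →L[ℝ] ℝ := g ((extChartAt I p).symm y)
  B.bilinearComp D D

variable (M) in
/-- A smooth semi-Riemannian metric: a symmetric nondegenerate bilinear form on every tangent
space, of arbitrary signature, with smooth components in every chart. -/
structure SemiRiemannianMetric [IsManifold I ∞ M] where
  /-- The bilinear form on each tangent space. -/
  val : ∀ q : M, TangentSpace I q →L[ℝ] TangentSpace I q →L[ℝ] ℝ
  symm : ∀ q u v, val q u v = val q v u
  nondegenerate : ∀ q u, (∀ v, val q u v = 0) → u = 0
  smooth : ∀ p : M, ContDiffOn ℝ ∞ (chartExpression I val p) (extChartAt I p).target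

namespace SemiRiemannianMetric

variable {I} [IsManifold I ∞ M]

/-- Scalar curvature of `g` at `p`, computed in the chart around `p`. -/
def scalarCurvature [FiniteDimensional ℝ E] (g : SemiRiemannianMetric I M) (p : M) : ℝ :=
  LocalGeometry.scalarCurvature (chartExpression I g.val p) (extChartAt I p p)

/-- Hessian of `h` at `p`, computed in the chart around `p`. In Mathlib the tangent space
`TangentSpace I p` is the model space `E`, a vector `u : E` being the tangent vector at `p` with
components `u` in this same chart. -/
def hessian (g : SemiRiemannianMetric I M) (h : M → ℝ) (p : M) (u v : TangentSpace I p) : ℝ :=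
  LocalGeometry.hessian (chartExpression I g.val p) (h ∘ (extChartAt I p).symm)
    (extChartAt I p p) u v

/-- `(M, g)` is a gradient Yamabe soliton with potential function `h` and soliton constant `ρ`:
`h` is smooth and `(S_g - ρ) g = Hess h`. -/
def IsGradientYamabeSoliton [FiniteDimensional ℝ E] (g : SemiRiemannianMetric I M)
    (h : M → ℝ) (ρ : ℝ) : Prop :=
  ContMDiff I 𝓘(ℝ, ℝ) ∞ h ∧
    ∀ (p : M) (u v : TangentSpace I p),
      (g.scalarCurvature p - ρ) * g.val p u v = g.hessian h p u v

/-- The conformal metric `φ⁻² g`. -/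
def conformal (g : SemiRiemannianMetric I M) (φ : M → ℝ) (hφ : ContMDiff I 𝓘(ℝ, ℝ) ∞ φ)
    (hφ0 : ∀ q, φ q ≠ 0) : SemiRiemannianMetric I M where
  val q := (φ q ^ 2)⁻¹ • g.val q
  symm q u v := by simp [g.symm q u v]
  nondegenerate q u hu := by
    refine g.nondegenerate q u fun v => ?_
    have := hu v
    simpa [hφ0 q] using this
  smooth p := by
    have h1 : ContDiffOn ℝ ∞ (φ ∘ (extChartAt I p).symm) (extChartAt I p).target := by
      rw [← contMDiffOn_iff_contDiffOn]
      exact hφ.comp_contMDiffOn (contMDiffOn_extChartAt_symm p)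
    have h2 := ((h1.pow 2).inv (fun y _ => pow_ne_zero 2 (hφ0 _))).smul (g.smooth p)
    refine h2.congr fun y _ => ?_
    rfl

section Warped

variable {E' : Type*} [NormedAddCommGroup E'] [NormedSpace ℝ E']
  {H' : Type*} [TopologicalSpace H'] {I' : ModelWithCorners ℝ E' H'} [I'.Boundaryless]
  {N : Type*} [TopologicalSpace N] [ChartedSpace H' N] [IsManifold I' ∞ N]

/-- The bilinear form `g_B ⊕ f² g_F` on the tangent spaces of `B × F`. -/
def warpedVal (gB : SemiRiemannianMetric I M) (f : M → ℝ) (gF : SemiRiemannianMetric I' N)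
    (q : M × N) : TangentSpace (I.prod I') q →L[ℝ] TangentSpace (I.prod I') q →L[ℝ] ℝ :=
  let B : E →L[ℝ] E →L[ℝ] ℝ := gB.val q.1
  let C : E' →L[ℝ] E' →L[ℝ] ℝ := gF.val q.2
  let π₁ : E × E' →L[ℝ] E := ContinuousLinearMap.fst ℝ E E'
  let π₂ : E × E' →L[ℝ] E' := ContinuousLinearMap.snd ℝ E E'
  (B.bilinearComp π₁ π₁ + (f q.1) ^ 2 • C.bilinearComp π₂ π₂ : E × E' →L[ℝ] E × E' →L[ℝ] ℝ)

theorem chartExpression_warpedVal (gB : SemiRiemannianMetric I M) (f : M → ℝ)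
    (gF : SemiRiemannianMetric I' N) (p : M × N) {y : E × E'}
    (hy : y ∈ (extChartAt (I.prod I') p).target) :
    chartExpression (I.prod I') (warpedVal gB f gF) p y =
      (chartExpression I gB.val p.1 y.1).bilinearComp
          (ContinuousLinearMap.fst ℝ E E') (ContinuousLinearMap.fst ℝ E E')
        + f ((extChartAt I p.1).symm y.1) ^ 2 • (chartExpression I' gF.val p.2 y.2).bilinearComp
          (ContinuousLinearMap.snd ℝ E E') (ContinuousLinearMap.snd ℝ E E') := by
  rw [extChartAt_prod] at hy
  have h1 := mdifferentiableWithinAt_extChartAt_symm (I := I) hy.1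
  have h2 := mdifferentiableWithinAt_extChartAt_symm (I := I') hy.2
  rw [I.range_eq_univ, mdifferentiableWithinAt_univ] at h1
  rw [I'.range_eq_univ, mdifferentiableWithinAt_univ] at h2
  have h3 := mfderiv_prodMap (p := y) h1 h2
  have h4 : (mfderiv (𝓘(ℝ, E × E')) (I.prod I') (extChartAt (I.prod I') p).symm y :
        E × E' →L[ℝ] E × E') =
      ContinuousLinearMap.prodMap (mfderiv 𝓘(ℝ, E) I (extChartAt I p.1).symm y.1 : E →L[ℝ] E)
        (mfderiv 𝓘(ℝ, E') I' (extChartAt I' p.2).symm y.2 : E' →L[ℝ] E') := by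
    rw [extChartAt_prod, modelWithCornersSelf_prod, ← chartedSpaceSelf_prod]
    exact h3
  refine ContinuousLinearMap.ext fun u => ContinuousLinearMap.ext fun v => ?_
  simp only [chartExpression, h4]
  rfl

/-- The warped product metric `g_B ⊕ f² g_F` on `B × F`. -/
def warpedProduct (gB : SemiRiemannianMetric I M) (f : M → ℝ) (hf : ContMDiff I 𝓘(ℝ, ℝ) ∞ f)
    (hf0 : ∀ q, 0 < f q) (gF : SemiRiemannianMetric I' N) :
    SemiRiemannianMetric (I.prod I') (M × N) where
  val := warpedVal gB f gF
  symm q u v := by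
    change gB.val q.1 u.1 v.1 + f q.1 ^ 2 * gF.val q.2 u.2 v.2 =
      gB.val q.1 v.1 u.1 + f q.1 ^ 2 * gF.val q.2 v.2 u.2
    rw [gB.symm q.1 u.1 v.1, gF.symm q.2 u.2 v.2]
  nondegenerate q u hu := by
    have h1 : u.1 = 0 := gB.nondegenerate q.1 u.1 fun v => by
      have h := hu ((v, 0) : E × E')
      change gB.val q.1 u.1 v + f q.1 ^ 2 * gF.val q.2 u.2 (0 : TangentSpace I' q.2) = 0 at h
      rwa [map_zero, mul_zero, add_zero] at h
    have h2 : u.2 = 0 := gF.nondegenerate q.2 u.2 fun v => by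
      have h := hu ((0, v) : E × E')
      change gB.val q.1 u.1 (0 : TangentSpace I q.1) + f q.1 ^ 2 * gF.val q.2 u.2 v = 0 at h
      rw [map_zero, zero_add] at h
      exact (mul_eq_zero.1 h).resolve_left (pow_ne_zero 2 (hf0 q.1).ne')
    exact Prod.ext h1 h2
  smooth p := by
    have h1 : ContDiffOn ℝ ∞ (f ∘ (extChartAt I p.1).symm) (extChartAt I p.1).target := by
      rw [← contMDiffOn_iff_contDiffOn]
      exact hf.comp_contMDiffOn (contMDiffOn_extChartAt_symm p.1)
    refine ContDiffOn.congr ?_ fun y hy => chartExpression_warpedVal gB f gF p hy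
    rw [extChartAt_prod]
    have hB : ContDiffOn ℝ ∞ (fun y : E × E' => chartExpression I gB.val p.1 y.1)
        ((extChartAt I p.1).target ×ˢ (extChartAt I' p.2).target) :=
      (gB.smooth p.1).comp contDiffOn_fst fun y hy => hy.1
    have hF : ContDiffOn ℝ ∞ (fun y : E × E' => chartExpression I' gF.val p.2 y.2)
        ((extChartAt I p.1).target ×ˢ (extChartAt I' p.2).target) :=
      (gF.smooth p.2).comp contDiffOn_snd fun y hy => hy.2
    have hf2 : ContDiffOn ℝ ∞ (fun y : E × E' => f ((extChartAt I p.1).symm y.1) ^ 2)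
        ((extChartAt I p.1).target ×ˢ (extChartAt I' p.2).target) :=
      (h1.comp contDiffOn_fst fun y hy => hy.1).pow 2
    exact (contDiffOn_bilinearComp hB _).add (hf2.smul (contDiffOn_bilinearComp hF _))

end Warped

end SemiRiemannianMetric

end Manifolds

/-- The bilinear form `(u, v) ↦ ∑ i, ε_i u_i v_i` on `ℝⁿ`. -/
def pseudoEuclideanForm {n : ℕ} (ε : Fin n → ℝ) :
    EuclideanSpace ℝ (Fin n) →L[ℝ] EuclideanSpace ℝ (Fin n) →L[ℝ] ℝ :=
  ∑ i, ε i • (EuclideanSpace.proj i : EuclideanSpace ℝ (Fin n) →L[ℝ] ℝ).smulRight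
    (EuclideanSpace.proj i : EuclideanSpace ℝ (Fin n) →L[ℝ] ℝ)

theorem pseudoEuclideanForm_apply {n : ℕ} (ε : Fin n → ℝ) (u v : EuclideanSpace ℝ (Fin n)) :
    pseudoEuclideanForm ε u v = ∑ i, ε i * (u i * v i) := by
  simp [pseudoEuclideanForm]

/-- The pseudo-Euclidean metric `g_{ij} = δ_{ij} ε_i` on `ℝⁿ`, with `ε_i = ±1`. -/
def pseudoEuclidean {n : ℕ} (ε : Fin n → ℝ) (hε : ∀ i, ε i = 1 ∨ ε i = -1) :
    SemiRiemannianMetric (𝓡 n) (EuclideanSpace ℝ (Fin n)) where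
  val _ := pseudoEuclideanForm ε
  symm _ u v := by
    refine (pseudoEuclideanForm_apply ε u v).trans ?_
    refine Eq.trans ?_ (pseudoEuclideanForm_apply ε v u).symm
    exact Finset.sum_congr rfl fun i _ => by ring
  nondegenerate _ u hu := by
    refine PiLp.ext fun i => ?_
    have h := (pseudoEuclideanForm_apply ε u (EuclideanSpace.single i 1)).symm.trans (hu _)
    have hi : ε i ≠ 0 := by rcases hε i with h | h <;> simp [h]
    change (show EuclideanSpace ℝ (Fin n) from u) i = 0
    simpa [hi] using h
  smooth p := by
    refine ContDiffOn.congr (f := fun _ => pseudoEuclideanForm ε) contDiffOn_const fun y _ => ?_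
    have hD : (mfderiv (𝓡 n) (𝓡 n) (extChartAt (𝓡 n) p).symm y :
        EuclideanSpace ℝ (Fin n) →L[ℝ] EuclideanSpace ℝ (Fin n)) =
        ContinuousLinearMap.id ℝ (EuclideanSpace ℝ (Fin n)) := by
      rw [extChartAt_model_space_eq_id]
      exact mfderiv_id
    simp only [chartExpression, hD]
    rfl

/-- The partial derivative `∂u/∂x_i` of a function on `ℝⁿ`. -/
def partialDeriv {n : ℕ} (i : Fin n) (u : EuclideanSpace ℝ (Fin n) → ℝ)
    (x : EuclideanSpace ℝ (Fin n)) : ℝ :=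
  fderiv ℝ u x (EuclideanSpace.single i 1)

end

/-! The computation rests on the identity `B ⊕ f² C = f² (f⁻² B ⊕ C)`: a warped product is conformal
to a product. Hence two facts about local metrics suffice, both proved for arbitrary metrics on a
finite-dimensional space.

* `scalarCurvature_conformalMetric`, `covDeriv_conformalMetric`, `laplacian_conformalMetric`: how
  the scalar curvature, the Hessian and the Laplacian change from `G` to `ψ⁻² G`. Everything is
  expressed through the covector field `a = - dψ / ψ` and its covariant derivative; the curvature
  formula `riemann_conformalMetric` is traced twice.
* `scalarCurvature_prodMetric`: the connection and the curvature of a product are direct sums.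

They give the classical formulas `scalarCurvature_warpedMetric` and `hessian_warpedMetric`. With
`B = φ⁻² ∑ ε_i dx_i²`, conformal to a flat metric, these become explicit expressions in partial
derivatives. All objects on manifolds are computed in the chart centred at the point in question,
where the chart identifies the tangent space with the model space by the identity.

The soliton equation then has no mixed part, and splits into an equation of bilinear forms on `ℝⁿ`,
which is tested on pairs of coordinate vectors, and a multiple of `g_F`, which is tested on vectors
with `g_F (U, V) ≠ 0`; these exist because `F` is nonempty of positive dimension. -/

namespace LocalGeometry

open Filter Topology

/-! ### Metric germs, covariant derivatives and traces -/

section General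

variable {E : Type*} [NormedAddCommGroup E] [NormedSpace ℝ E]

/-- `G` is a semi-Riemannian metric on the germ of `E` at `x`, of class `C²` at `x`. Invertibility
is only recorded at `x`, since it is an open condition. -/
structure IsMetricAt (G : E → E →L[ℝ] E →L[ℝ] ℝ) (x : E) : Prop where
  contDiffAt : ContDiffAt ℝ 2 G x
  symm : ∀ᶠ y in 𝓝 x, ∀ u v, G y u v = G y v u
  isInvertible : (G x).IsInvertible

/-- The covariant derivative `∇a (u, v) = (∇_u a) v` of a covector field `a`. -/
noncomputable def covDeriv (G : E → E →L[ℝ] E →L[ℝ] ℝ) (a : E → E →L[ℝ] ℝ) (x : E) :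
    E →L[ℝ] E →L[ℝ] ℝ :=
  fderiv ℝ a x - (ContinuousLinearMap.compL ℝ E E ℝ (a x)) ∘L christoffel G x

theorem covDeriv_apply (G : E → E →L[ℝ] E →L[ℝ] ℝ) (a : E → E →L[ℝ] ℝ) (x u v : E) :
    covDeriv G a x u v = fderiv ℝ a x u v - a x (christoffel G x u v) := by
  simp [covDeriv]

/-- The metric trace of a bilinear form `b` with respect to `g`: the trace of the endomorphism
obtained by raising the second index of `b`. -/
noncomputable def metricTrace (g b : E →L[ℝ] E →L[ℝ] ℝ) : ℝ :=
  LinearMap.trace ℝ E (g.inverse ∘L b).toLinearMap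

/-- The Laplacian of a function, the metric trace of its Hessian. -/
noncomputable def laplacian (G : E → E →L[ℝ] E →L[ℝ] ℝ) (h : E → ℝ) (x : E) : ℝ :=
  metricTrace (G x) (covDeriv G (fderiv ℝ h) x)

/-- The pairing `⟨∇h, ∇k⟩` of the gradients of two functions. -/
noncomputable def gradInner (G : E → E →L[ℝ] E →L[ℝ] ℝ) (h k : E → ℝ) (x : E) : ℝ :=
  fderiv ℝ h x ((G x).inverse (fderiv ℝ k x))

theorem metricTrace_add (g b c : E →L[ℝ] E →L[ℝ] ℝ) :
    metricTrace g (b + c) = metricTrace g b + metricTrace g c := by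
  simp [metricTrace]

theorem metricTrace_smul (g b : E →L[ℝ] E →L[ℝ] ℝ) (r : ℝ) :
    metricTrace g (r • b) = r * metricTrace g b := by
  simp [metricTrace]

theorem metricTrace_sub (g b c : E →L[ℝ] E →L[ℝ] ℝ) :
    metricTrace g (b - c) = metricTrace g b - metricTrace g c := by
  simp [metricTrace]

theorem metricTrace_self [FiniteDimensional ℝ E] {g : E →L[ℝ] E →L[ℝ] ℝ} (hg : g.IsInvertible) :
    metricTrace g g = Module.finrank ℝ E := by
  rw [metricTrace, hg.inverse_comp_self]
  exact LinearMap.trace_id ℝ E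

theorem metricTrace_smulRight [FiniteDimensional ℝ E] (g : E →L[ℝ] E →L[ℝ] ℝ) (a b : E →L[ℝ] ℝ) :
    metricTrace g (a.smulRight b) = a (g.inverse b) := by
  have : (g.inverse ∘L a.smulRight b).toLinearMap = a.toLinearMap.smulRight (g.inverse b) := by
    ext u; simp
  rw [metricTrace, this, LinearMap.trace_smulRight]
  rfl

theorem isInvertible_smul {g : E →L[ℝ] E →L[ℝ] ℝ} (hg : g.IsInvertible) {r : ℝ} (hr : r ≠ 0) :
    (r • g).IsInvertible := by
  refine ContinuousLinearMap.IsInvertible.of_inverse (g := r⁻¹ • g.inverse) ?_ ?_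
  · ext c : 1
    simp [hg.self_apply_inverse, smul_smul, hr]
  · ext c : 1
    simp [hg.inverse_apply_self, smul_smul, hr]

theorem inverse_smul_apply {g : E →L[ℝ] E →L[ℝ] ℝ} (hg : g.IsInvertible) {r : ℝ} (hr : r ≠ 0)
    (b : E →L[ℝ] ℝ) : (r • g).inverse b = r⁻¹ • g.inverse b := by
  rw [(isInvertible_smul hg hr).inverse_apply_eq]
  simp [hg.self_apply_inverse, smul_smul, hr]

/-- The derivative of a family of bilinear maps may be computed on fixed arguments. -/
theorem fderiv_apply₂ {X Y Z : Type*} [NormedAddCommGroup X] [NormedSpace ℝ X]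
    [NormedAddCommGroup Y] [NormedSpace ℝ Y] [NormedAddCommGroup Z] [NormedSpace ℝ Z]
    {T : E → X →L[ℝ] Y →L[ℝ] Z} {x : E} (hT : DifferentiableAt ℝ T x) (u : E) (v : X) (w : Y) :
    fderiv ℝ T x u v w = fderiv ℝ (fun y => T y v w) x u := by
  rw [fderiv_clm_apply (by fun_prop) (by fun_prop), fderiv_clm_apply hT (by fun_prop)]
  simp

theorem christoffel_eventuallyEq {G G' : E → E →L[ℝ] E →L[ℝ] ℝ} {x : E} (h : G =ᶠ[𝓝 x] G') :
    christoffel G =ᶠ[𝓝 x] christoffel G' := by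
  filter_upwards [h.eventuallyEq_nhds] with y hy
  rw [christoffel, christoffel, christoffelFirst, christoffelFirst, hy.fderiv_eq, hy.eq_of_nhds]

theorem hessian_congr {G G' : E → E →L[ℝ] E →L[ℝ] ℝ} {x : E} (h : G =ᶠ[𝓝 x] G') (k : E → ℝ) :
    hessian G k x = hessian G' k x := by
  ext u v
  rw [hessian, hessian, (christoffel_eventuallyEq h).eq_of_nhds]

theorem riemann_congr {G G' : E → E →L[ℝ] E →L[ℝ] ℝ} {x : E} (h : G =ᶠ[𝓝 x] G') :
    riemann G x = riemann G' x := by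
  have h1 := christoffel_eventuallyEq h
  ext v w u
  simp only [riemann, h1.fderiv_eq, h1.eq_of_nhds]

theorem scalarCurvature_congr [FiniteDimensional ℝ E] {G G' : E → E →L[ℝ] E →L[ℝ] ℝ} {x : E}
    (h : G =ᶠ[𝓝 x] G') : scalarCurvature G x = scalarCurvature G' x := by
  simp only [scalarCurvature, ricci, riemann_congr h, h.eq_of_nhds]

theorem ricci_apply (G : E → E →L[ℝ] E →L[ℝ] ℝ) (x v w : E) :
    ricci G x v w = LinearMap.trace ℝ E (riemann G x v w) := rfl

theorem scalarCurvature_eq_metricTrace [FiniteDimensional ℝ E] (G : E → E →L[ℝ] E →L[ℝ] ℝ) (x : E)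
    {b : E →L[ℝ] E →L[ℝ] ℝ} (hb : ∀ v w, b v w = ricci G x v w) :
    scalarCurvature G x = metricTrace (G x) b := by
  rw [scalarCurvature, metricTrace]
  congr 1
  ext v
  simp only [LinearMap.comp_apply, ContinuousLinearMap.coe_coe, ContinuousLinearMap.comp_apply]
  congr 1
  ext w
  exact (hb v w).symm

namespace IsMetricAt

variable {G : E → E →L[ℝ] E →L[ℝ] ℝ} {x : E}

theorem differentiableAt (hG : IsMetricAt G x) : DifferentiableAt ℝ G x :=
  hG.contDiffAt.differentiableAt (by norm_num)

theorem apply_comm (hG : IsMetricAt G x) (u v : E) : G x u v = G x v u := hG.symm.self_of_nhds u v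

theorem eventually [CompleteSpace E] (hG : IsMetricAt G x) : ∀ᶠ y in 𝓝 x, IsMetricAt G y := by
  obtain ⟨e, he⟩ := hG.isInvertible
  have h3 : ∀ᶠ y in 𝓝 x, (G y).IsInvertible :=
    hG.contDiffAt.continuousAt.eventually (by rw [← he]; exact e.nhds)
  filter_upwards [hG.contDiffAt.eventually (by decide), hG.symm.eventually_nhds, h3]
    with y h1 h2 h3 using ⟨h1, h2, h3⟩

theorem fderiv_comm (hG : IsMetricAt G x) (z u v : E) :
    fderiv ℝ G x z u v = fderiv ℝ G x z v u := by
  rw [fderiv_apply₂ hG.differentiableAt, fderiv_apply₂ hG.differentiableAt]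
  have : (fun y => G y u v) =ᶠ[𝓝 x] fun y => G y v u := hG.symm.mono fun y hy => hy u v
  rw [this.fderiv_eq]

theorem christoffel_comm (hG : IsMetricAt G x) (u v : E) :
    christoffel G x u v = christoffel G x v u := by
  rw [christoffel_apply, christoffel_apply]
  congr 1
  ext w
  rw [christoffelFirst_apply, christoffelFirst_apply, hG.fderiv_comm w u v]
  ring

theorem apply_christoffel (hG : IsMetricAt G x) (u v w : E) :
    G x (christoffel G x u v) w = christoffelFirst G x u v w := by
  rw [christoffel_apply, hG.isInvertible.self_apply_inverse]

/-- The inverse metric is symmetric. -/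
theorem inverse_comm (hG : IsMetricAt G x) (a b : E →L[ℝ] ℝ) :
    a ((G x).inverse b) = b ((G x).inverse a) := by
  conv_lhs => rw [← hG.isInvertible.self_apply_inverse a]
  rw [hG.apply_comm, hG.isInvertible.self_apply_inverse]

/-- The Levi-Civita connection is compatible with the metric: `∇G = 0`. -/
theorem fderiv_apply (hG : IsMetricAt G x) (z u v : E) :
    fderiv ℝ G x z u v = G x (christoffel G x z u) v + G x u (christoffel G x z v) := by
  rw [hG.apply_comm u, hG.apply_christoffel, hG.apply_christoffel, christoffelFirst_apply,
    christoffelFirst_apply, hG.fderiv_comm z v u, hG.fderiv_comm v z u, hG.fderiv_comm u z v]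
  ring

/-- The Christoffel symbols are determined by their symbols of the first kind. -/
theorem christoffel_eq (hG : IsMetricAt G x) {u v t : E}
    (h : ∀ w, G x t w = christoffelFirst G x u v w) : christoffel G x u v = t := by
  apply hG.isInvertible.injective
  ext w
  rw [hG.apply_christoffel, h]

theorem differentiableAt_inverse [CompleteSpace E] (hG : IsMetricAt G x) :
    DifferentiableAt ℝ (fun y => (G y).inverse) x :=
  ((hG.isInvertible.contDiffAt_map_inverse (n := 1)).differentiableAt (by norm_num)).comp x
    hG.differentiableAt

theorem differentiableAt_christoffel [CompleteSpace E] (hG : IsMetricAt G x) :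
    DifferentiableAt ℝ (christoffel G) x := by
  have h1 : DifferentiableAt ℝ (fderiv ℝ G) x :=
    (hG.contDiffAt.fderiv_right (m := 1) (by norm_num)).differentiableAt (by norm_num)
  have h2 : DifferentiableAt ℝ (fun y => (fderiv ℝ G y).flip) x :=
    (ContinuousLinearMap.flipₗᵢ ℝ E E (E →L[ℝ] ℝ)).toContinuousLinearEquiv.differentiableAt.comp
      x h1
  have h3 : DifferentiableAt ℝ (christoffelFirst G) x := by
    unfold christoffelFirst
    exact ((h1.add h2).sub ((differentiableAt_const _).clm_comp h2)).const_smul (1 / 2 : ℝ)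
  unfold christoffel
  exact ((ContinuousLinearMap.differentiableAt _).comp x hG.differentiableAt_inverse).clm_comp h3

/-- Raising an index commutes with covariant differentiation: the vector field `a♯` dual to `a` has
`∇_u a♯ = (∇_u a)♯`. -/
theorem fderiv_sharp [CompleteSpace E] (hG : IsMetricAt G x) {a : E → E →L[ℝ] ℝ}
    (ha : DifferentiableAt ℝ a x) (u : E) :
    fderiv ℝ (fun y => (G y).inverse (a y)) x u =
      (G x).inverse (covDeriv G a x u) - christoffel G x u ((G x).inverse (a x)) := by
  have hs : DifferentiableAt ℝ (fun y => (G y).inverse (a y)) x :=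
    hG.differentiableAt_inverse.clm_apply ha
  have hev : (fun y => G y ((G y).inverse (a y))) =ᶠ[𝓝 x] a := by
    filter_upwards [hG.eventually] with y hy
    exact hy.isInvertible.self_apply_inverse _
  have h1 := hev.fderiv_eq (𝕜 := ℝ)
  rw [fderiv_clm_apply hG.differentiableAt hs] at h1
  apply hG.isInvertible.injective
  ext v
  have h2 := congr($h1 u v)
  simp only [add_apply, ContinuousLinearMap.comp_apply,
    ContinuousLinearMap.flip_apply, hG.fderiv_apply] at h2
  simp only [map_sub, sub_apply, hG.isInvertible.self_apply_inverse, covDeriv_apply] at h2 ⊢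
  linarith

end IsMetricAt

end General

end LocalGeometry

namespace LocalGeometry

open Filter Topology

/-! ### Conformal change of metric -/

section Conformal

variable {E : Type*} [NormedAddCommGroup E] [NormedSpace ℝ E]

/-- The conformal metric `ψ⁻² G`. -/
noncomputable def conformalMetric (G : E → E →L[ℝ] E →L[ℝ] ℝ) (ψ : E → ℝ) (x : E) :
    E →L[ℝ] E →L[ℝ] ℝ :=
  (ψ x ^ 2)⁻¹ • G x

/-- The logarithmic differential `a = - dψ / ψ` of the conformal factor `ψ⁻¹`. -/
noncomputable def logDiff (ψ : E → ℝ) (x : E) : E →L[ℝ] ℝ := (-(ψ x)⁻¹) • fderiv ℝ ψ x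

variable {G : E → E →L[ℝ] E →L[ℝ] ℝ} {ψ : E → ℝ} {x : E}

theorem IsMetricAt.conformalMetric (hG : IsMetricAt G x) (hψ : ContDiffAt ℝ 2 ψ x)
    (h0 : ψ x ≠ 0) : IsMetricAt (conformalMetric G ψ) x where
  contDiffAt := ((hψ.pow 2).inv (pow_ne_zero 2 h0)).smul hG.contDiffAt
  symm := by
    filter_upwards [hG.symm] with y hy u v
    simp [LocalGeometry.conformalMetric, hy u v]
  isInvertible := isInvertible_smul hG.isInvertible (inv_ne_zero (pow_ne_zero 2 h0))

theorem fderiv_conformalMetric (hG : IsMetricAt G x) (hψ : DifferentiableAt ℝ ψ x)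
    (h0 : ψ x ≠ 0) (z u v : E) :
    fderiv ℝ (conformalMetric G ψ) x z u v =
      (ψ x ^ 2)⁻¹ * (fderiv ℝ G x z u v + 2 * logDiff ψ x z * G x u v) := by
  have h1 : HasFDerivAt (fun y => (ψ y ^ 2)⁻¹) (-(2 * (ψ x ^ 3)⁻¹) • fderiv ℝ ψ x) x := by
    have h2 := (hasDerivAt_inv (pow_ne_zero 2 h0)).comp_hasFDerivAt x (hψ.hasFDerivAt.pow 2)
    refine h2.congr_fderiv ?_
    ext u
    simp
    field_simp
  have h3 : fderiv ℝ (conformalMetric G ψ) x = _ :=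
    (h1.smul hG.differentiableAt.hasFDerivAt).fderiv
  rw [h3]
  simp [logDiff]
  field_simp

/-- Christoffel symbols of `ψ⁻² G`: with `a = - dψ / ψ`,
`Γ' (u, v) = Γ (u, v) + a(u) v + a(v) u - G(u, v) a♯`. -/
theorem christoffel_conformalMetric (hG : IsMetricAt G x) (hψ : ContDiffAt ℝ 2 ψ x)
    (h0 : ψ x ≠ 0) (u v : E) :
    christoffel (conformalMetric G ψ) x u v =
      christoffel G x u v + logDiff ψ x u • v + logDiff ψ x v • u
        - G x u v • (G x).inverse (logDiff ψ x) := by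
  apply (hG.conformalMetric hψ h0).christoffel_eq
  intro w
  have hd := hψ.differentiableAt (by norm_num)
  have hs : G x ((G x).inverse (logDiff ψ x)) = logDiff ψ x := hG.isInvertible.self_apply_inverse _
  rw [christoffelFirst_apply]
  simp only [fderiv_conformalMetric hG hd h0]
  simp only [conformalMetric, smul_apply, map_add, map_sub, map_smul, add_apply, sub_apply, hs,
    smul_eq_mul, hG.apply_christoffel, christoffelFirst_apply]
  ring

theorem differentiableAt_logDiff (hψ : ContDiffAt ℝ 2 ψ x) (h0 : ψ x ≠ 0) :
    DifferentiableAt ℝ (logDiff ψ) x := by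
  have h1 : DifferentiableAt ℝ (fderiv ℝ ψ) x :=
    (hψ.fderiv_right (m := 1) (by norm_num)).differentiableAt (by norm_num)
  exact ((hψ.differentiableAt (by norm_num)).inv h0).neg.smul h1

theorem fderiv_christoffel_conformalMetric [CompleteSpace E] (hG : IsMetricAt G x)
    (hψ : ContDiffAt ℝ 2 ψ x) (h0 : ψ x ≠ 0) (u v w : E) :
    fderiv ℝ (christoffel (conformalMetric G ψ)) x u v w =
      fderiv ℝ (christoffel G) x u v w + fderiv ℝ (logDiff ψ) x u v • w
        + fderiv ℝ (logDiff ψ) x u w • v - fderiv ℝ G x u v w • (G x).inverse (logDiff ψ x)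
        - G x v w • ((G x).inverse (covDeriv G (logDiff ψ) x u)
            - christoffel G x u ((G x).inverse (logDiff ψ x))) := by
  have hev : (fun y => christoffel (conformalMetric G ψ) y v w) =ᶠ[𝓝 x]
      fun y => christoffel G y v w + logDiff ψ y v • w + logDiff ψ y w • v
        - G y v w • (G y).inverse (logDiff ψ y) := by
    filter_upwards [hG.eventually, hψ.eventually (by decide), hψ.continuousAt.eventually_ne h0]
      with y h1 h2 h3 using christoffel_conformalMetric h1 h2 h3 v w
  have ha := differentiableAt_logDiff hψ h0
  have hΓ := hG.differentiableAt_christoffel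
  have hG1 := hG.differentiableAt
  have hs : DifferentiableAt ℝ (fun y => (G y).inverse (logDiff ψ y)) x :=
    hG.differentiableAt_inverse.clm_apply ha
  have d1 : DifferentiableAt ℝ (fun y => christoffel G y v w) x := by fun_prop
  have d2 : ∀ v, DifferentiableAt ℝ (fun y => logDiff ψ y v) x := fun v => by fun_prop
  have d3 : DifferentiableAt ℝ (fun y => G y v w) x := by fun_prop
  have e2 : ∀ v, fderiv ℝ (fun y => logDiff ψ y v) x u = fderiv ℝ (logDiff ψ) x u v := fun v => by
    rw [fderiv_clm_apply ha (by fun_prop)]; simp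
  rw [fderiv_apply₂ (hG.conformalMetric hψ h0).differentiableAt_christoffel, hev.fderiv_eq,
    fderiv_fun_sub (by fun_prop) (d3.fun_smul hs), fderiv_fun_add (by fun_prop) (by fun_prop),
    fderiv_fun_add (by fun_prop) (by fun_prop), fderiv_fun_smul d3 hs,
    fderiv_smul_const (d2 v), fderiv_smul_const (d2 w)]
  simp only [sub_apply, add_apply, ContinuousLinearMap.smulRight_apply, smul_apply, e2,
    ← fderiv_apply₂ hΓ, ← fderiv_apply₂ hG1, hG.fderiv_sharp ha]
  module

theorem fderiv_logDiff (hψ : ContDiffAt ℝ 2 ψ x) (h0 : ψ x ≠ 0) :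
    fderiv ℝ (logDiff ψ) x = (-(ψ x)⁻¹) • fderiv ℝ (fderiv ℝ ψ) x
      + (ψ x ^ 2)⁻¹ • (fderiv ℝ ψ x).smulRight (fderiv ℝ ψ x) := by
  have h1 : DifferentiableAt ℝ (fderiv ℝ ψ) x :=
    (hψ.fderiv_right (m := 1) (by norm_num)).differentiableAt (by norm_num)
  have h2 : HasFDerivAt (fun y => -(ψ y)⁻¹) ((ψ x ^ 2)⁻¹ • fderiv ℝ ψ x) x := by
    have := ((hasDerivAt_inv h0).comp_hasFDerivAt x
      (hψ.differentiableAt (by norm_num)).hasFDerivAt).neg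
    refine this.congr_fderiv ?_
    ext u
    simp
  have h3 : fderiv ℝ (logDiff ψ) x = _ := (h2.smul h1.hasFDerivAt).fderiv
  rw [h3]
  ext u v
  simp [mul_assoc]

theorem covDeriv_logDiff (hψ : ContDiffAt ℝ 2 ψ x) (h0 : ψ x ≠ 0) :
    covDeriv G (logDiff ψ) x = (-(ψ x)⁻¹) • covDeriv G (fderiv ℝ ψ) x
      + (ψ x ^ 2)⁻¹ • (fderiv ℝ ψ x).smulRight (fderiv ℝ ψ x) := by
  ext u v
  rw [covDeriv_apply, fderiv_logDiff hψ h0]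
  simp only [logDiff, add_apply, smul_apply, covDeriv_apply, smul_eq_mul]
  ring

theorem covDeriv_fderiv_comm (hG : IsMetricAt G x) (hψ : ContDiffAt ℝ 2 ψ x) (u v : E) :
    covDeriv G (fderiv ℝ ψ) x u v = covDeriv G (fderiv ℝ ψ) x v u := by
  rw [covDeriv_apply, covDeriv_apply, hG.christoffel_comm u v,
    (hψ.isSymmSndFDerivAt (by simp)).eq u v]

theorem covDeriv_logDiff_comm (hG : IsMetricAt G x) (hψ : ContDiffAt ℝ 2 ψ x) (h0 : ψ x ≠ 0)
    (u v : E) : covDeriv G (logDiff ψ) x u v = covDeriv G (logDiff ψ) x v u := by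
  simp only [covDeriv_logDiff hψ h0, add_apply, smul_apply, ContinuousLinearMap.smulRight_apply,
    smul_eq_mul, covDeriv_fderiv_comm hG hψ u v]
  ring

/-- Curvature of `ψ⁻² G`. With `a = - dψ / ψ`, it differs from the curvature of `G` by terms in
the metric, in `a` and in `∇a` only. -/
theorem riemann_conformalMetric [CompleteSpace E] (hG : IsMetricAt G x)
    (hψ : ContDiffAt ℝ 2 ψ x) (h0 : ψ x ≠ 0) (v w u : E) :
    riemann (conformalMetric G ψ) x v w u =
      riemann G x v w u
        + covDeriv G (logDiff ψ) x u w • v - covDeriv G (logDiff ψ) x v w • u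
        - G x v w • (G x).inverse (covDeriv G (logDiff ψ) x u)
        + G x u w • (G x).inverse (covDeriv G (logDiff ψ) x v)
        + (logDiff ψ x v * logDiff ψ x w) • u - (logDiff ψ x u * logDiff ψ x w) • v
        - logDiff ψ x ((G x).inverse (logDiff ψ x)) • (G x v w • u - G x u w • v)
        + (logDiff ψ x u * G x v w - logDiff ψ x v * G x u w) • (G x).inverse (logDiff ψ x) := by
  have hc := covDeriv_logDiff_comm hG hψ h0 u v
  have hs : ∀ z, G x z ((G x).inverse (logDiff ψ x)) = logDiff ψ x z := fun z => by
    rw [hG.apply_comm, hG.isInvertible.self_apply_inverse]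
  simp only [riemann, LinearMap.coe_mk, AddHom.coe_mk,
    fderiv_christoffel_conformalMetric hG hψ h0, christoffel_conformalMetric hG hψ h0,
    hG.fderiv_apply]
  simp only [map_add, map_sub, map_smul, hs, smul_eq_mul, covDeriv_apply] at hc ⊢
  rw [hG.christoffel_comm v u] at hc ⊢
  rw [hG.apply_comm v u, hG.apply_comm v (christoffel G x u w), sub_left_inj.1 hc]
  module

/-- Covariant derivative of a covector field with respect to `ψ⁻² G`; for `b = dh` this is the
Hessian of `h`. -/
theorem covDeriv_conformalMetric (hG : IsMetricAt G x) (hψ : ContDiffAt ℝ 2 ψ x)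
    (h0 : ψ x ≠ 0) (b : E → E →L[ℝ] ℝ) (u v : E) :
    covDeriv (conformalMetric G ψ) b x u v =
      covDeriv G b x u v - logDiff ψ x u * b x v - logDiff ψ x v * b x u
        + G x u v * b x ((G x).inverse (logDiff ψ x)) := by
  rw [covDeriv_apply, covDeriv_apply, christoffel_conformalMetric hG hψ h0]
  simp only [map_add, map_sub, map_smul, smul_eq_mul]
  ring

theorem gradInner_conformalMetric (hG : IsMetricAt G x) (h0 : ψ x ≠ 0) (h k : E → ℝ) :
    gradInner (conformalMetric G ψ) h k x = ψ x ^ 2 * gradInner G h k x := by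
  simp only [gradInner, conformalMetric]
  rw [inverse_smul_apply hG.isInvertible (inv_ne_zero (pow_ne_zero 2 h0)), inv_inv, map_smul,
    smul_eq_mul]

theorem metricTrace_conformalMetric (hG : IsMetricAt G x) (h0 : ψ x ≠ 0)
    (b : E →L[ℝ] E →L[ℝ] ℝ) :
    metricTrace (conformalMetric G ψ x) b = ψ x ^ 2 * metricTrace (G x) b := by
  have : ((conformalMetric G ψ x).inverse ∘L b).toLinearMap
      = ψ x ^ 2 • ((G x).inverse ∘L b).toLinearMap := by
    ext u
    simp only [ContinuousLinearMap.coe_coe, ContinuousLinearMap.comp_apply, conformalMetric,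
      LinearMap.smul_apply]
    rw [inverse_smul_apply hG.isInvertible (inv_ne_zero (pow_ne_zero 2 h0)), inv_inv]
  rw [metricTrace, this, map_smul]
  rfl

variable [FiniteDimensional ℝ E]

theorem ricci_conformalMetric (hG : IsMetricAt G x)
    (hψ : ContDiffAt ℝ 2 ψ x) (h0 : ψ x ≠ 0) (v w : E) :
    ricci (conformalMetric G ψ) x v w =
      ricci G x v w
        - (Module.finrank ℝ E - 2) * (covDeriv G (logDiff ψ) x v w - logDiff ψ x v * logDiff ψ x w)
        - (metricTrace (G x) (covDeriv G (logDiff ψ) x)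
            + (Module.finrank ℝ E - 2) * logDiff ψ x ((G x).inverse (logDiff ψ x))) * G x v w := by
  have : CompleteSpace E := FiniteDimensional.complete ℝ E
  have hs : ∀ z, G x z ((G x).inverse (logDiff ψ x)) = logDiff ψ x z := fun z => by
    rw [hG.apply_comm, hG.isInvertible.self_apply_inverse]
  -- the covectors `u ↦ ∇a (u, w)` and `u ↦ G (u, w)`
  let H : E →ₗ[ℝ] ℝ := ((covDeriv G (logDiff ψ) x).flip w).toLinearMap
  let g : E →ₗ[ℝ] ℝ := (G x w).toLinearMap
  let a : E →ₗ[ℝ] ℝ := (logDiff ψ x).toLinearMap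
  have key : riemann (conformalMetric G ψ) x v w =
      riemann G x v w + H.smulRight v - covDeriv G (logDiff ψ) x v w • LinearMap.id
        - G x v w • ((G x).inverse ∘L covDeriv G (logDiff ψ) x).toLinearMap
        + g.smulRight ((G x).inverse (covDeriv G (logDiff ψ) x v))
        + (logDiff ψ x v * logDiff ψ x w) • LinearMap.id - logDiff ψ x w • a.smulRight v
        - logDiff ψ x ((G x).inverse (logDiff ψ x)) • (G x v w • LinearMap.id - g.smulRight v)
        + (G x v w • a.smulRight ((G x).inverse (logDiff ψ x))
          - logDiff ψ x v • g.smulRight ((G x).inverse (logDiff ψ x))) := by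
    ext u
    rw [riemann_conformalMetric hG hψ h0]
    simp only [LinearMap.add_apply, LinearMap.sub_apply, LinearMap.smul_apply,
      LinearMap.smulRight_apply, LinearMap.id_apply, ContinuousLinearMap.coe_coe,
      ContinuousLinearMap.comp_apply, ContinuousLinearMap.flip_apply, H, g, a,
      hG.apply_comm w u]
    module
  rw [ricci_apply, key]
  simp only [map_add, map_sub, map_smul, LinearMap.trace_smulRight, LinearMap.trace_id, H, g, a,
    ContinuousLinearMap.coe_coe, ContinuousLinearMap.flip_apply, smul_eq_mul, hs, metricTrace,
    ricci_apply]
  rw [hG.apply_comm w ((G x).inverse _), hG.isInvertible.self_apply_inverse, hG.apply_comm w v]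
  ring

/-- Scalar curvature of `ψ⁻² G` in dimension `N`:
`S' = ψ² S + (N - 1) (2 ψ Δψ - N |∇ψ|²)`. -/
theorem scalarCurvature_conformalMetric (hG : IsMetricAt G x)
    (hψ : ContDiffAt ℝ 2 ψ x) (h0 : ψ x ≠ 0) :
    scalarCurvature (conformalMetric G ψ) x =
      ψ x ^ 2 * scalarCurvature G x + (Module.finrank ℝ E - 1) *
        (2 * ψ x * laplacian G ψ x - Module.finrank ℝ E * gradInner G ψ ψ x) := by
  let N : ℝ := Module.finrank ℝ E
  let Ric : E →L[ℝ] E →L[ℝ] ℝ :=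
    LinearMap.toContinuousLinearMap (LinearMap.toContinuousLinearMap.toLinearMap ∘ₗ ricci G x)
  let R' : E →L[ℝ] E →L[ℝ] ℝ :=
    Ric - (N - 2) • (covDeriv G (logDiff ψ) x - (logDiff ψ x).smulRight (logDiff ψ x))
      - (metricTrace (G x) (covDeriv G (logDiff ψ) x)
          + (N - 2) * logDiff ψ x ((G x).inverse (logDiff ψ x))) • G x
  have h1 := scalarCurvature_eq_metricTrace (conformalMetric G ψ) x (b := R') fun v w => by
    rw [ricci_conformalMetric hG hψ h0]
    rfl
  have h2 : scalarCurvature G x = metricTrace (G x) Ric :=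
    scalarCurvature_eq_metricTrace G x fun v w => rfl
  have h4 : metricTrace (G x) (covDeriv G (logDiff ψ) x) =
      -(ψ x)⁻¹ * laplacian G ψ x + (ψ x ^ 2)⁻¹ * gradInner G ψ ψ x := by
    rw [covDeriv_logDiff hψ h0, metricTrace_add, metricTrace_smul, metricTrace_smul,
      metricTrace_smulRight, laplacian, gradInner]
  have h5 : logDiff ψ x ((G x).inverse (logDiff ψ x)) = (ψ x ^ 2)⁻¹ * gradInner G ψ ψ x := by
    simp only [logDiff, map_smul, smul_apply, smul_eq_mul, gradInner]
    field_simp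
  rw [h1, metricTrace_conformalMetric hG h0, h2]
  simp only [R', metricTrace_sub, metricTrace_smul, metricTrace_smulRight, h4, h5,
    metricTrace_self hG.isInvertible, N]
  field_simp
  ring

/-- Laplacian of `ψ⁻² G` in dimension `N`: `Δ' k = ψ² Δk - (N - 2) ψ ⟨∇ψ, ∇k⟩`. -/
theorem laplacian_conformalMetric (hG : IsMetricAt G x) (hψ : ContDiffAt ℝ 2 ψ x)
    (h0 : ψ x ≠ 0) (k : E → ℝ) :
    laplacian (conformalMetric G ψ) k x =
      ψ x ^ 2 * laplacian G k x - (Module.finrank ℝ E - 2) * ψ x * gradInner G ψ k x := by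
  have h1 : covDeriv (conformalMetric G ψ) (fderiv ℝ k) x = covDeriv G (fderiv ℝ k) x
      - (logDiff ψ x).smulRight (fderiv ℝ k x) - (fderiv ℝ k x).smulRight (logDiff ψ x)
      + fderiv ℝ k x ((G x).inverse (logDiff ψ x)) • G x := by
    ext u v
    rw [covDeriv_conformalMetric hG hψ h0]
    simp only [add_apply, sub_apply, smul_apply, ContinuousLinearMap.smulRight_apply, smul_eq_mul]
    ring
  rw [laplacian, metricTrace_conformalMetric hG h0, h1, metricTrace_add, metricTrace_sub,
    metricTrace_sub, metricTrace_smul, metricTrace_smulRight, metricTrace_smulRight,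
    metricTrace_self hG.isInvertible]
  have h2 : logDiff ψ x ((G x).inverse (fderiv ℝ k x)) = -(ψ x)⁻¹ * gradInner G ψ k x := by
    simp [logDiff, gradInner]
  have h3 : fderiv ℝ k x ((G x).inverse (logDiff ψ x)) = -(ψ x)⁻¹ * gradInner G ψ k x := by
    rw [← h2, hG.inverse_comm]
  rw [h2, h3, laplacian]
  field_simp
  ring

end Conformal

end LocalGeometry

namespace LocalGeometry

open Filter Topology

/-! ### Product metrics -/

section Product

variable {E E' : Type*} [NormedAddCommGroup E] [NormedSpace ℝ E]
  [NormedAddCommGroup E'] [NormedSpace ℝ E']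

/-- The product metric `B ⊕ C`. -/
noncomputable def prodMetric (B : E → E →L[ℝ] E →L[ℝ] ℝ) (C : E' → E' →L[ℝ] E' →L[ℝ] ℝ)
    (y : E × E') : E × E' →L[ℝ] E × E' →L[ℝ] ℝ :=
  (B y.1).bilinearComp (ContinuousLinearMap.fst ℝ E E') (ContinuousLinearMap.fst ℝ E E')
    + (C y.2).bilinearComp (ContinuousLinearMap.snd ℝ E E') (ContinuousLinearMap.snd ℝ E E')

variable {B : E → E →L[ℝ] E →L[ℝ] ℝ} {C : E' → E' →L[ℝ] E' →L[ℝ] ℝ} {x : E × E'}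

theorem prodMetric_apply (u v : E × E') :
    prodMetric B C x u v = B x.1 u.1 v.1 + C x.2 u.2 v.2 := rfl

theorem contDiff_bilinearComp {X Y : Type*} [NormedAddCommGroup X] [NormedSpace ℝ X]
    [NormedAddCommGroup Y] [NormedSpace ℝ Y] (π : Y →L[ℝ] X) :
    ContDiff ℝ 2 fun β : X →L[ℝ] X →L[ℝ] ℝ => β.bilinearComp π π := by
  let L : (X →L[ℝ] X →L[ℝ] ℝ) →L[ℝ] (Y →L[ℝ] Y →L[ℝ] ℝ) :=
    ContinuousLinearMap.compL ℝ Y (X →L[ℝ] ℝ) (Y →L[ℝ] ℝ)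
        ((ContinuousLinearMap.compL ℝ Y X ℝ).flip π)
      ∘L (ContinuousLinearMap.compL ℝ Y X (X →L[ℝ] ℝ)).flip π
  exact L.contDiff

theorem inverse_prodMetric_apply (hB : (B x.1).IsInvertible) (hC : (C x.2).IsInvertible) :
    (prodMetric B C x).IsInvertible ∧ ∀ b : E × E' →L[ℝ] ℝ, (prodMetric B C x).inverse b =
      ((B x.1).inverse (b ∘L ContinuousLinearMap.inl ℝ E E'),
        (C x.2).inverse (b ∘L ContinuousLinearMap.inr ℝ E E')) := by
  have hi : (prodMetric B C x).IsInvertible := by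
    refine ContinuousLinearMap.IsInvertible.of_inverse
      (g := ((B x.1).inverse ∘L
          (ContinuousLinearMap.compL ℝ E (E × E') ℝ).flip (ContinuousLinearMap.inl ℝ E E')).prod
        ((C x.2).inverse ∘L
          (ContinuousLinearMap.compL ℝ E' (E × E') ℝ).flip (ContinuousLinearMap.inr ℝ E E')))
      ?_ ?_
    · ext b u <;> simp [prodMetric_apply, hB.self_apply_inverse, hC.self_apply_inverse] <;>
        exact map_zero b
    · refine ContinuousLinearMap.ext fun u => Prod.ext ?_ ?_
      · simp only [ContinuousLinearMap.comp_apply, ContinuousLinearMap.prod_apply,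
          ContinuousLinearMap.id_apply]
        rw [hB.inverse_apply_eq]
        ext v; simp [prodMetric_apply]
      · simp only [ContinuousLinearMap.comp_apply, ContinuousLinearMap.prod_apply,
          ContinuousLinearMap.id_apply]
        rw [hC.inverse_apply_eq]
        ext v; simp [prodMetric_apply]
  refine ⟨hi, fun b => ?_⟩
  rw [hi.inverse_apply_eq]
  ext v <;> simp [prodMetric_apply, hB.self_apply_inverse, hC.self_apply_inverse] <;>
    exact map_zero b

theorem IsMetricAt.prodMetric (hB : IsMetricAt B x.1) (hC : IsMetricAt C x.2) :
    IsMetricAt (prodMetric B C) x where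
  contDiffAt :=
    ((contDiff_bilinearComp _).contDiffAt.comp x (hB.contDiffAt.comp x contDiffAt_fst)).add
      ((contDiff_bilinearComp _).contDiffAt.comp x (hC.contDiffAt.comp x contDiffAt_snd))
  symm := by
    filter_upwards [continuousAt_fst.eventually hB.symm, continuousAt_snd.eventually hC.symm]
      with y h1 h2 u v
    rw [prodMetric_apply, prodMetric_apply, h1, h2]
  isInvertible := (inverse_prodMetric_apply hB.isInvertible hC.isInvertible).1

theorem fderiv_prodMetric (hB : IsMetricAt B x.1) (hC : IsMetricAt C x.2) (z u v : E × E') :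
    fderiv ℝ (prodMetric B C) x z u v =
      fderiv ℝ B x.1 z.1 u.1 v.1 + fderiv ℝ C x.2 z.2 u.2 v.2 := by
  have h1 : HasFDerivAt (fun y : E × E' => B y.1 u.1 v.1) _ x :=
    (((hB.differentiableAt.clm_apply (differentiableAt_const u.1)).clm_apply
      (differentiableAt_const v.1)).hasFDerivAt).comp x hasFDerivAt_fst
  have h2 : HasFDerivAt (fun y : E × E' => C y.2 u.2 v.2) _ x :=
    (((hC.differentiableAt.clm_apply (differentiableAt_const u.2)).clm_apply
      (differentiableAt_const v.2)).hasFDerivAt).comp x hasFDerivAt_snd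
  rw [fderiv_apply₂ (hB.prodMetric hC).differentiableAt, fderiv_apply₂ hB.differentiableAt,
    fderiv_apply₂ hC.differentiableAt]
  have h3 : fderiv ℝ (fun y => prodMetric B C y u v) x = _ := (h1.add h2).fderiv
  rw [h3]
  rfl

theorem christoffel_prodMetric (hB : IsMetricAt B x.1) (hC : IsMetricAt C x.2) (u v : E × E') :
    christoffel (prodMetric B C) x u v =
      (christoffel B x.1 u.1 v.1, christoffel C x.2 u.2 v.2) := by
  apply (hB.prodMetric hC).christoffel_eq
  intro w
  rw [prodMetric_apply, hB.apply_christoffel, hC.apply_christoffel]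
  simp only [christoffelFirst_apply, fderiv_prodMetric hB hC]
  ring

variable [FiniteDimensional ℝ E] [FiniteDimensional ℝ E']

theorem fderiv_christoffel_prodMetric (hB : IsMetricAt B x.1) (hC : IsMetricAt C x.2)
    (z u v : E × E') :
    fderiv ℝ (christoffel (prodMetric B C)) x z u v =
      (fderiv ℝ (christoffel B) x.1 z.1 u.1 v.1, fderiv ℝ (christoffel C) x.2 z.2 u.2 v.2) := by
  have : CompleteSpace E := FiniteDimensional.complete ℝ E
  have : CompleteSpace E' := FiniteDimensional.complete ℝ E'
  have hev : (fun y => christoffel (prodMetric B C) y u v) =ᶠ[𝓝 x]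
      fun y => (christoffel B y.1 u.1 v.1, christoffel C y.2 u.2 v.2) := by
    filter_upwards [continuousAt_fst.eventually hB.eventually,
      continuousAt_snd.eventually hC.eventually] with y h1 h2 using christoffel_prodMetric h1 h2 u v
  have h1 : HasFDerivAt (fun y : E × E' => christoffel B y.1 u.1 v.1) _ x :=
    (((hB.differentiableAt_christoffel.clm_apply (differentiableAt_const u.1)).clm_apply
      (differentiableAt_const v.1)).hasFDerivAt).comp x hasFDerivAt_fst
  have h2 : HasFDerivAt (fun y : E × E' => christoffel C y.2 u.2 v.2) _ x :=
    (((hC.differentiableAt_christoffel.clm_apply (differentiableAt_const u.2)).clm_apply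
      (differentiableAt_const v.2)).hasFDerivAt).comp x hasFDerivAt_snd
  rw [fderiv_apply₂ (hB.prodMetric hC).differentiableAt_christoffel, hev.fderiv_eq,
    fderiv_apply₂ hB.differentiableAt_christoffel, fderiv_apply₂ hC.differentiableAt_christoffel,
    (h1.prodMk h2).fderiv]
  rfl

theorem ricci_prodMetric (hB : IsMetricAt B x.1) (hC : IsMetricAt C x.2) (v w : E × E') :
    ricci (prodMetric B C) x v w = ricci B x.1 v.1 w.1 + ricci C x.2 v.2 w.2 := by
  have key : riemann (prodMetric B C) x v w =
      (riemann B x.1 v.1 w.1).prodMap (riemann C x.2 v.2 w.2) := by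
    refine LinearMap.ext fun u => ?_
    simp only [riemann, LinearMap.coe_mk, AddHom.coe_mk, fderiv_christoffel_prodMetric hB hC,
      christoffel_prodMetric hB hC]
    rfl
  rw [ricci_apply, key, LinearMap.trace_prodMap']
  rfl

theorem metricTrace_prodMetric (hB : IsMetricAt B x.1) (hC : IsMetricAt C x.2)
    {b : E × E' →L[ℝ] E × E' →L[ℝ] ℝ} {b₁ : E →L[ℝ] E →L[ℝ] ℝ} {b₂ : E' →L[ℝ] E' →L[ℝ] ℝ}
    (h : ∀ u v, b u v = b₁ u.1 v.1 + b₂ u.2 v.2) :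
    metricTrace (prodMetric B C x) b = metricTrace (B x.1) b₁ + metricTrace (C x.2) b₂ := by
  rw [metricTrace, metricTrace, metricTrace, ← LinearMap.trace_prodMap']
  congr 1
  refine LinearMap.ext fun u => ?_
  simp only [ContinuousLinearMap.coe_coe, ContinuousLinearMap.comp_apply,
    (inverse_prodMetric_apply hB.isInvertible hC.isInvertible).2, LinearMap.prodMap_apply]
  congr 2 <;> (ext v; simp [h])

/-- The scalar curvature of a product is the sum of the scalar curvatures. -/
theorem scalarCurvature_prodMetric (hB : IsMetricAt B x.1) (hC : IsMetricAt C x.2) :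
    scalarCurvature (prodMetric B C) x = scalarCurvature B x.1 + scalarCurvature C x.2 := by
  let Ric₁ : E →L[ℝ] E →L[ℝ] ℝ :=
    LinearMap.toContinuousLinearMap (LinearMap.toContinuousLinearMap.toLinearMap ∘ₗ ricci B x.1)
  let Ric₂ : E' →L[ℝ] E' →L[ℝ] ℝ :=
    LinearMap.toContinuousLinearMap (LinearMap.toContinuousLinearMap.toLinearMap ∘ₗ ricci C x.2)
  let Ric : E × E' →L[ℝ] E × E' →L[ℝ] ℝ := LinearMap.toContinuousLinearMap
    (LinearMap.toContinuousLinearMap.toLinearMap ∘ₗ ricci (prodMetric B C) x)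
  rw [scalarCurvature_eq_metricTrace _ _ (b := Ric) fun _ _ => rfl,
    scalarCurvature_eq_metricTrace _ _ (b := Ric₁) fun _ _ => rfl,
    scalarCurvature_eq_metricTrace _ _ (b := Ric₂) fun _ _ => rfl]
  exact metricTrace_prodMetric hB hC fun u v => ricci_prodMetric hB hC u v

end Product

/-! ### Warped products in a chart -/

section Warped

variable {E E' : Type*} [NormedAddCommGroup E] [NormedSpace ℝ E]
  [NormedAddCommGroup E'] [NormedSpace ℝ E']

/-- The warped product metric `B ⊕ f² C`. -/
noncomputable def warpedMetric (B : E → E →L[ℝ] E →L[ℝ] ℝ) (f : E → ℝ)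
    (C : E' → E' →L[ℝ] E' →L[ℝ] ℝ) (y : E × E') : E × E' →L[ℝ] E × E' →L[ℝ] ℝ :=
  (B y.1).bilinearComp (ContinuousLinearMap.fst ℝ E E') (ContinuousLinearMap.fst ℝ E E')
    + f y.1 ^ 2 • (C y.2).bilinearComp (ContinuousLinearMap.snd ℝ E E')
      (ContinuousLinearMap.snd ℝ E E')

variable {B : E → E →L[ℝ] E →L[ℝ] ℝ} {C : E' → E' →L[ℝ] E' →L[ℝ] ℝ} {f : E → ℝ} {x : E × E'}

/-- A warped product is conformal to a product: `B ⊕ f² C = f² (f⁻² B ⊕ C)`. -/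
theorem warpedMetric_eventuallyEq (hf : ContinuousAt f x.1) (h0 : f x.1 ≠ 0) :
    warpedMetric B f C =ᶠ[𝓝 x]
      conformalMetric (prodMetric (conformalMetric B f) C) (fun y => (f y.1)⁻¹) := by
  filter_upwards [continuousAt_fst.eventually (hf.eventually_ne h0)] with y hy
  ext u v <;> simp [warpedMetric, conformalMetric, prodMetric_apply, hy]

theorem fderiv_comp_fst {h : E → ℝ} (hh : DifferentiableAt ℝ h x.1) :
    fderiv ℝ (fun y : E × E' => h y.1) x = fderiv ℝ h x.1 ∘L ContinuousLinearMap.fst ℝ E E' :=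
  (hh.hasFDerivAt.comp x hasFDerivAt_fst).fderiv

theorem fderiv_fderiv_comp_fst {h : E → ℝ} (hh : ContDiffAt ℝ 2 h x.1) (u v : E × E') :
    fderiv ℝ (fderiv ℝ (fun y : E × E' => h y.1)) x u v = fderiv ℝ (fderiv ℝ h) x.1 u.1 v.1 := by
  have hev : fderiv ℝ (fun y : E × E' => h y.1) =ᶠ[𝓝 x]
      fun y => fderiv ℝ h y.1 ∘L ContinuousLinearMap.fst ℝ E E' := by
    filter_upwards [continuousAt_fst.eventually (hh.eventually (by decide))] with y hy
      using fderiv_comp_fst (hy.differentiableAt (by norm_num))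
  have h1 : DifferentiableAt ℝ (fderiv ℝ h) x.1 :=
    (hh.fderiv_right (m := 1) (by norm_num)).differentiableAt (by norm_num)
  have h2 := ((ContinuousLinearMap.compL ℝ (E × E') E ℝ).flip
    (ContinuousLinearMap.fst ℝ E E')).hasFDerivAt.comp x (h1.hasFDerivAt.comp x hasFDerivAt_fst)
  have h3 : fderiv ℝ (fun y : E × E' => fderiv ℝ h y.1 ∘L ContinuousLinearMap.fst ℝ E E') x = _ :=
    h2.fderiv
  rw [hev.fderiv_eq, h3]
  rfl

theorem covDeriv_prodMetric_comp_fst {h : E → ℝ} (hB : IsMetricAt B x.1) (hC : IsMetricAt C x.2)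
    (hh : ContDiffAt ℝ 2 h x.1) (u v : E × E') :
    covDeriv (prodMetric B C) (fderiv ℝ (fun y : E × E' => h y.1)) x u v =
      covDeriv B (fderiv ℝ h) x.1 u.1 v.1 := by
  rw [covDeriv_apply, covDeriv_apply, fderiv_fderiv_comp_fst hh,
    fderiv_comp_fst (hh.differentiableAt (by norm_num)), christoffel_prodMetric hB hC]
  rfl

theorem gradInner_prodMetric_comp_fst {h k : E → ℝ} (hB : IsMetricAt B x.1)
    (hC : IsMetricAt C x.2) (hh : DifferentiableAt ℝ h x.1) (hk : DifferentiableAt ℝ k x.1) :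
    gradInner (prodMetric B C) (fun y : E × E' => h y.1) (fun y => k y.1) x =
      gradInner B h k x.1 := by
  have : (fderiv ℝ k x.1 ∘L ContinuousLinearMap.fst ℝ E E') ∘L ContinuousLinearMap.inl ℝ E E' =
      fderiv ℝ k x.1 := by ext; simp
  rw [gradInner, fderiv_comp_fst hh, fderiv_comp_fst hk,
    (inverse_prodMetric_apply hB.isInvertible hC.isInvertible).2, this]
  rfl

theorem fderiv_inv_eq {x : E} (hf : DifferentiableAt ℝ f x) (h0 : f x ≠ 0) :
    fderiv ℝ (fun y => (f y)⁻¹) x = (f x)⁻¹ • logDiff f x := by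
  have := (hasDerivAt_inv h0).comp_hasFDerivAt x hf.hasFDerivAt
  have h : fderiv ℝ (fun y => (f y)⁻¹) x = _ := this.fderiv
  rw [h]
  ext u
  simp [logDiff]
  field_simp

theorem logDiff_inv {x : E} (hf : DifferentiableAt ℝ f x) (h0 : f x ≠ 0) :
    logDiff (fun y => (f y)⁻¹) x = (f x)⁻¹ • fderiv ℝ f x := by
  rw [logDiff, fderiv_inv_eq hf h0]
  ext u
  simp [logDiff, h0]

theorem fderiv_fderiv_inv {x : E} (hf : ContDiffAt ℝ 2 f x) (h0 : f x ≠ 0) (u v : E) :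
    fderiv ℝ (fderiv ℝ (fun y => (f y)⁻¹)) x u v = -(f x ^ 2)⁻¹ * fderiv ℝ (fderiv ℝ f) x u v
      + 2 * (f x ^ 3)⁻¹ * fderiv ℝ f x u * fderiv ℝ f x v := by
  have hev : fderiv ℝ (fun y => (f y)⁻¹) =ᶠ[𝓝 x] fun y => (f y)⁻¹ • logDiff f y := by
    filter_upwards [hf.eventually (by decide), hf.continuousAt.eventually_ne h0] with y h1 h2
      using fderiv_inv_eq (h1.differentiableAt (by norm_num)) h2
  have hd := hf.differentiableAt (by norm_num : (2 : ℕ∞ω) ≠ 0)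
  rw [hev.fderiv_eq, fderiv_fun_smul (hd.fun_inv h0) (differentiableAt_logDiff hf h0),
    fderiv_logDiff hf h0, fderiv_inv_eq hd h0]
  simp [logDiff]
  field_simp
  ring

/-- Hessian on the warped product `B ⊕ f² C` of a function `h` of the base: the Hessian of `h` on
the base, plus `f ⟨∇f, ∇h⟩ C` on the fibre. -/
theorem hessian_warpedMetric {h : E → ℝ} (hB : IsMetricAt B x.1) (hC : IsMetricAt C x.2)
    (hf : ContDiffAt ℝ 2 f x.1) (h0 : f x.1 ≠ 0) (hh : ContDiffAt ℝ 2 h x.1) (u v : E × E') :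
    hessian (warpedMetric B f C) (fun y => h y.1) x u v =
      hessian B h x.1 u.1 v.1 + f x.1 * gradInner B f h x.1 * C x.2 u.2 v.2 := by
  have hB' := hB.conformalMetric hf h0
  have hi : ContDiffAt ℝ 2 (fun y : E × E' => (f y.1)⁻¹) x := (hf.inv h0).comp x contDiffAt_fst
  have hd := hf.differentiableAt (by norm_num : (2 : ℕ∞ω) ≠ 0)
  have hdh := hh.differentiableAt (by norm_num : (2 : ℕ∞ω) ≠ 0)
  have hL : logDiff (fun y : E × E' => (f y.1)⁻¹) x =
      ((f x.1)⁻¹ • fderiv ℝ f x.1) ∘L ContinuousLinearMap.fst ℝ E E' := by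
    rw [logDiff_inv (f := fun y : E × E' => f y.1) (hd.comp x differentiableAt_fst) h0,
      fderiv_comp_fst hd]
    rfl
  have hs : (((f x.1)⁻¹ • fderiv ℝ f x.1) ∘L ContinuousLinearMap.fst ℝ E E') ∘L
      ContinuousLinearMap.inl ℝ E E' = (f x.1)⁻¹ • fderiv ℝ f x.1 := by ext; simp
  have hg : gradInner B f h x.1 = fderiv ℝ h x.1 ((B x.1).inverse (fderiv ℝ f x.1)) :=
    hB.inverse_comm _ _
  have h1 := covDeriv_conformalMetric (hB'.prodMetric hC) hi (inv_ne_zero h0)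
    (fderiv ℝ (fun y : E × E' => h y.1)) u v
  have h2 := covDeriv_conformalMetric hB hf h0 (fderiv ℝ h) u.1 v.1
  rw [hessian_congr (warpedMetric_eventuallyEq hf.continuousAt h0)]
  refine ((covDeriv_apply _ _ _ _ _).symm.trans h1).trans ?_
  rw [covDeriv_prodMetric_comp_fst hB' hC hh, h2, hL, fderiv_comp_fst hdh,
    (inverse_prodMetric_apply hB'.isInvertible hC.isInvertible).2, hs]
  simp only [prodMetric_apply, conformalMetric, ContinuousLinearMap.comp_apply,
    ContinuousLinearMap.coe_fst', smul_apply, smul_eq_mul, logDiff]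
  rw [inverse_smul_apply hB.isInvertible (inv_ne_zero (pow_ne_zero 2 h0)), inv_inv, hg]
  simp only [map_smul, smul_eq_mul, hessian, covDeriv_apply]
  field_simp
  ring

variable [FiniteDimensional ℝ E] [FiniteDimensional ℝ E']

theorem laplacian_prodMetric_comp_fst {h : E → ℝ} (hB : IsMetricAt B x.1) (hC : IsMetricAt C x.2)
    (hh : ContDiffAt ℝ 2 h x.1) :
    laplacian (prodMetric B C) (fun y : E × E' => h y.1) x = laplacian B h x.1 := by
  rw [laplacian, metricTrace_prodMetric (b₁ := covDeriv B (fderiv ℝ h) x.1) (b₂ := 0) hB hC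
    fun u v => by rw [covDeriv_prodMetric_comp_fst hB hC hh]; simp]
  simp [laplacian, metricTrace]

theorem laplacian_inv {x : E} (B : E → E →L[ℝ] E →L[ℝ] ℝ) (hf : ContDiffAt ℝ 2 f x)
    (h0 : f x ≠ 0) :
    laplacian B (fun y => (f y)⁻¹) x =
      -(f x ^ 2)⁻¹ * laplacian B f x + 2 * (f x ^ 3)⁻¹ * gradInner B f f x := by
  have : covDeriv B (fderiv ℝ (fun y => (f y)⁻¹)) x = (-(f x ^ 2)⁻¹) • covDeriv B (fderiv ℝ f) x
      + (2 * (f x ^ 3)⁻¹) • (fderiv ℝ f x).smulRight (fderiv ℝ f x) := by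
    ext u v
    rw [covDeriv_apply, fderiv_fderiv_inv hf h0,
      fderiv_inv_eq (hf.differentiableAt (by norm_num)) h0]
    simp only [add_apply, smul_apply, covDeriv_apply, ContinuousLinearMap.smulRight_apply,
      smul_eq_mul, logDiff]
    field_simp
    ring
  rw [laplacian, this, metricTrace_add, metricTrace_smul, metricTrace_smul, metricTrace_smulRight]
  rfl

/-- Scalar curvature of the warped product `B ⊕ f² C` with fibre of dimension `m`:
`S = S_B + S_C / f² - 2 m Δf / f - m (m - 1) |∇f|² / f²`. -/
theorem scalarCurvature_warpedMetric (hB : IsMetricAt B x.1) (hC : IsMetricAt C x.2)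
    (hf : ContDiffAt ℝ 2 f x.1) (h0 : f x.1 ≠ 0) :
    scalarCurvature (warpedMetric B f C) x =
      scalarCurvature B x.1 + scalarCurvature C x.2 / f x.1 ^ 2
        - 2 * Module.finrank ℝ E' / f x.1 * laplacian B f x.1
        - Module.finrank ℝ E' * (Module.finrank ℝ E' - 1) / f x.1 ^ 2 * gradInner B f f x.1 := by
  have hB' := hB.conformalMetric hf h0
  have hi : ContDiffAt ℝ 2 (fun y => (f y)⁻¹) x.1 := hf.inv h0
  have hi' : ContDiffAt ℝ 2 (fun y : E × E' => (f y.1)⁻¹) x := hi.comp x contDiffAt_fst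
  have hd := hf.differentiableAt (by norm_num : (2 : ℕ∞ω) ≠ 0)
  have hg1 : gradInner B f (fun y => (f y)⁻¹) x.1 = -(f x.1 ^ 2)⁻¹ * gradInner B f f x.1 := by
    simp only [gradInner, fderiv_inv_eq hd h0, logDiff, map_smul, smul_eq_mul]
    field_simp
  have hg2 : gradInner B (fun y => (f y)⁻¹) (fun y => (f y)⁻¹) x.1 =
      (f x.1 ^ 4)⁻¹ * gradInner B f f x.1 := by
    simp only [gradInner, fderiv_inv_eq hd h0, logDiff, map_smul, smul_eq_mul, smul_apply]
    field_simp
  rw [scalarCurvature_congr (warpedMetric_eventuallyEq hf.continuousAt h0),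
    scalarCurvature_conformalMetric (hB'.prodMetric hC) hi' (inv_ne_zero h0),
    scalarCurvature_prodMetric hB' hC, scalarCurvature_conformalMetric hB hf h0,
    laplacian_prodMetric_comp_fst (h := fun y => (f y)⁻¹) hB' hC hi,
    gradInner_prodMetric_comp_fst (h := fun y => (f y)⁻¹) (k := fun y => (f y)⁻¹) hB' hC
      (hd.inv h0) (hd.inv h0),
    laplacian_conformalMetric hB hf h0, gradInner_conformalMetric hB h0, laplacian_inv B hf h0,
    hg1, hg2, Module.finrank_prod]
  push_cast
  field_simp
  ring

end Warped

end LocalGeometry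

namespace LocalGeometry

open Filter Topology

/-! ### The conformally flat base -/

section PseudoEuclidean

/-- A nondegenerate bilinear form on a finite-dimensional space is an isomorphism onto the dual. -/
theorem isInvertible_of_nondegenerate {E : Type*} [NormedAddCommGroup E] [NormedSpace ℝ E]
    [FiniteDimensional ℝ E] {g : E →L[ℝ] E →L[ℝ] ℝ} (h : ∀ u, (∀ v, g u v = 0) → u = 0) :
    g.IsInvertible := by
  have hinj : Function.Injective g.toLinearMap := by
    rw [← LinearMap.ker_eq_bot, LinearMap.ker_eq_bot']
    intro u hu
    exact h u fun v => congr($hu v)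
  have hfin : Module.finrank ℝ E = Module.finrank ℝ (E →L[ℝ] ℝ) := by
    rw [← (LinearMap.toContinuousLinearMap (𝕜 := ℝ) (E := E) (F' := ℝ)).finrank_eq]
    exact Subspace.dual_finrank_eq.symm
  exact ⟨(LinearEquiv.ofInjectiveOfFinrankEq g.toLinearMap hinj hfin).toContinuousLinearEquiv,
    by ext; rfl⟩

variable {n : ℕ} {ε : Fin n → ℝ}

theorem isMetricAt_pseudoEuclideanForm (hε : ∀ i, ε i = 1 ∨ ε i = -1)
    (x : EuclideanSpace ℝ (Fin n)) : IsMetricAt (fun _ => pseudoEuclideanForm ε) x where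
  contDiffAt := contDiffAt_const
  symm := Eventually.of_forall fun _ => (pseudoEuclidean ε hε).symm x
  isInvertible := isInvertible_of_nondegenerate ((pseudoEuclidean ε hε).nondegenerate x)

theorem inverse_pseudoEuclideanForm_apply (hε : ∀ i, ε i = 1 ∨ ε i = -1)
    (b : EuclideanSpace ℝ (Fin n) →L[ℝ] ℝ) (i : Fin n) :
    (pseudoEuclideanForm ε).inverse b i = ε i * b (EuclideanSpace.single i 1) := by
  have hi := (isMetricAt_pseudoEuclideanForm hε 0).isInvertible
  have h1 := congr($(hi.self_apply_inverse b) (EuclideanSpace.single i 1))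
  rw [pseudoEuclideanForm_apply] at h1
  have h2 : ε i * ε i = 1 := by rcases hε i with h | h <;> simp [h]
  rw [← h1]
  simp [← mul_assoc, h2]

theorem apply_eq_sum_single (b : EuclideanSpace ℝ (Fin n) →L[ℝ] ℝ) (u : EuclideanSpace ℝ (Fin n)) :
    b u = ∑ k, u k * b (EuclideanSpace.single k 1) := by
  conv_lhs => rw [← (EuclideanSpace.basisFun (Fin n) ℝ).sum_repr u]
  simp

theorem christoffel_const {E : Type*} [NormedAddCommGroup E] [NormedSpace ℝ E]
    (g : E →L[ℝ] E →L[ℝ] ℝ) : christoffel (fun _ => g) = 0 := by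
  ext x u v
  have : christoffelFirst (fun _ : E => g) x u v = 0 := by
    ext w
    simp [christoffelFirst_apply]
  rw [christoffel_apply, this]
  simp

theorem scalarCurvature_const {E : Type*} [NormedAddCommGroup E] [NormedSpace ℝ E]
    [FiniteDimensional ℝ E] (g : E →L[ℝ] E →L[ℝ] ℝ) (x : E) :
    scalarCurvature (fun _ => g) x = 0 := by
  have h : ∀ v w, riemann (fun _ => g) x v w = 0 := fun v w => by
    refine LinearMap.ext fun u => ?_
    simp [riemann, christoffel_const]
  rw [scalarCurvature_eq_metricTrace _ x (b := 0) fun v w => by rw [ricci_apply, h]; simp]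
  simp [metricTrace]

theorem partialDeriv_partialDeriv {h : EuclideanSpace ℝ (Fin n) → ℝ} {x : EuclideanSpace ℝ (Fin n)}
    (hh : ContDiffAt ℝ 2 h x) (i j : Fin n) :
    partialDeriv j (partialDeriv i h) x =
      fderiv ℝ (fderiv ℝ h) x (EuclideanSpace.single j 1) (EuclideanSpace.single i 1) := by
  have h1 : DifferentiableAt ℝ (fderiv ℝ h) x :=
    (hh.fderiv_right (m := 1) (by norm_num)).differentiableAt (by norm_num)
  unfold partialDeriv
  rw [fderiv_clm_apply h1 (by fun_prop)]
  simp

theorem gradInner_pseudoEuclideanForm (hε : ∀ i, ε i = 1 ∨ ε i = -1)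
    (h k : EuclideanSpace ℝ (Fin n) → ℝ) (x : EuclideanSpace ℝ (Fin n)) :
    gradInner (fun _ => pseudoEuclideanForm ε) h k x =
      ∑ i, ε i * partialDeriv i h x * partialDeriv i k x := by
  rw [gradInner, apply_eq_sum_single]
  refine Finset.sum_congr rfl fun i _ => ?_
  rw [inverse_pseudoEuclideanForm_apply hε, partialDeriv, partialDeriv]
  ring

theorem laplacian_pseudoEuclideanForm (hε : ∀ i, ε i = 1 ∨ ε i = -1)
    {h : EuclideanSpace ℝ (Fin n) → ℝ} {x : EuclideanSpace ℝ (Fin n)} (hh : ContDiffAt ℝ 2 h x) :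
    laplacian (fun _ => pseudoEuclideanForm ε) h x =
      ∑ i, ε i * partialDeriv i (partialDeriv i h) x := by
  rw [laplacian, metricTrace, LinearMap.trace_eq_sum_inner _ (EuclideanSpace.basisFun (Fin n) ℝ)]
  refine Finset.sum_congr rfl fun i _ => ?_
  rw [partialDeriv_partialDeriv hh]
  simp [EuclideanSpace.inner_single_left, inverse_pseudoEuclideanForm_apply hε, covDeriv_apply,
    christoffel_const]

variable {φ : EuclideanSpace ℝ (Fin n) → ℝ} {x : EuclideanSpace ℝ (Fin n)}

/-- Hessian of `h` for the conformally flat metric `φ⁻² ∑ ε_i dx_i²`, on coordinate vectors. -/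
theorem hessian_conformal_pseudoEuclidean (hε : ∀ i, ε i = 1 ∨ ε i = -1)
    (hφ : ContDiffAt ℝ 2 φ x) (h0 : φ x ≠ 0) {h : EuclideanSpace ℝ (Fin n) → ℝ}
    (hh : ContDiffAt ℝ 2 h x) (i j : Fin n) :
    hessian (conformalMetric (fun _ => pseudoEuclideanForm ε) φ) h x
        (EuclideanSpace.single j 1) (EuclideanSpace.single i 1) =
      partialDeriv j (partialDeriv i h) x + partialDeriv j φ x / φ x * partialDeriv i h x
        + partialDeriv i φ x / φ x * partialDeriv j h x
        - (if i = j then ε i * ∑ k, ε k * (partialDeriv k φ x / φ x) * partialDeriv k h x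
            else 0) := by
  have hg := isMetricAt_pseudoEuclideanForm hε x
  have h1 := covDeriv_conformalMetric hg hφ h0 (fderiv ℝ h)
    (EuclideanSpace.single j 1) (EuclideanSpace.single i 1)
  refine ((covDeriv_apply _ _ _ _ _).symm.trans h1).trans ?_
  have h2 : fderiv ℝ h x ((pseudoEuclideanForm ε).inverse (logDiff φ x)) =
      -∑ k, ε k * (partialDeriv k φ x / φ x) * partialDeriv k h x := by
    rw [apply_eq_sum_single, ← Finset.sum_neg_distrib]
    refine Finset.sum_congr rfl fun k _ => ?_
    rw [inverse_pseudoEuclideanForm_apply hε]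
    simp only [logDiff, smul_apply, smul_eq_mul, partialDeriv]
    ring
  have h3 : pseudoEuclideanForm ε (EuclideanSpace.single j 1) (EuclideanSpace.single i 1) =
      if i = j then ε i else 0 := by
    rw [pseudoEuclideanForm_apply]
    simp [PiLp.single_apply, eq_comm]
  rw [h2, h3, partialDeriv_partialDeriv hh, covDeriv_apply, christoffel_const]
  simp only [logDiff, smul_apply, smul_eq_mul, partialDeriv, Pi.zero_apply, zero_apply, map_zero]
  split_ifs <;> ring

/-- Scalar curvature of the warped product of the conformally flat metric `φ⁻² ∑ ε_i dx_i²` with a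
fibre of dimension `m`, in coordinates. -/
theorem scalarCurvature_warped_conformal_pseudoEuclidean {E' : Type*} [NormedAddCommGroup E']
    [NormedSpace ℝ E'] [FiniteDimensional ℝ E'] (hε : ∀ i, ε i = 1 ∨ ε i = -1)
    (hφ : ContDiffAt ℝ 2 φ x) (h0 : φ x ≠ 0) {f : EuclideanSpace ℝ (Fin n) → ℝ}
    (hf : ContDiffAt ℝ 2 f x) (hf0 : f x ≠ 0) {C : E' → E' →L[ℝ] E' →L[ℝ] ℝ} {y : E'}
    (hC : IsMetricAt C y) :
    scalarCurvature
        (warpedMetric (conformalMetric (fun _ => pseudoEuclideanForm ε) φ) f C) (x, y) =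
      ((n : ℝ) - 1) * (2 * φ x * ∑ k, ε k * partialDeriv k (partialDeriv k φ) x
          - n * ∑ k, ε k * partialDeriv k φ x ^ 2)
        + scalarCurvature C y / f x ^ 2
        - 2 * Module.finrank ℝ E' / f x *
          (φ x ^ 2 * ∑ k, ε k * partialDeriv k (partialDeriv k f) x
            - ((n : ℝ) - 2) * φ x * ∑ k, ε k * partialDeriv k φ x * partialDeriv k f x)
        - Module.finrank ℝ E' * ((Module.finrank ℝ E' : ℝ) - 1) / f x ^ 2 * φ x ^ 2 *
          ∑ k, ε k * partialDeriv k f x ^ 2 := by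
  have hg := isMetricAt_pseudoEuclideanForm hε x
  have hsq : ∀ u : EuclideanSpace ℝ (Fin n) → ℝ, ∑ k, ε k * partialDeriv k u x ^ 2 =
      ∑ k, ε k * partialDeriv k u x * partialDeriv k u x := fun u =>
    Finset.sum_congr rfl fun k _ => by ring
  rw [scalarCurvature_warpedMetric (x := (x, y)) (hg.conformalMetric hφ h0) hC hf hf0,
    scalarCurvature_conformalMetric hg hφ h0, laplacian_conformalMetric hg hφ h0,
    gradInner_conformalMetric hg h0, scalarCurvature_const, laplacian_pseudoEuclideanForm hε hφ,
    laplacian_pseudoEuclideanForm hε hf, gradInner_pseudoEuclideanForm hε,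
    gradInner_pseudoEuclideanForm hε, gradInner_pseudoEuclideanForm hε, finrank_euclideanSpace,
    Fintype.card_fin, hsq, hsq]
  ring

end PseudoEuclidean

end LocalGeometry

/-! ### Passage from manifolds to charts -/

section Charts

open Filter Topology

variable {E : Type*} [NormedAddCommGroup E] [NormedSpace ℝ E]
  {H : Type*} [TopologicalSpace H] {I : ModelWithCorners ℝ E H} [I.Boundaryless]
  {M : Type*} [TopologicalSpace M] [ChartedSpace H M] [IsManifold I ∞ M]
  {E' : Type*} [NormedAddCommGroup E'] [NormedSpace ℝ E']
  {H' : Type*} [TopologicalSpace H'] {I' : ModelWithCorners ℝ E' H'} [I'.Boundaryless]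
  {N : Type*} [TopologicalSpace N] [ChartedSpace H' N] [IsManifold I' ∞ N]

/-- At its centre `p`, the chart around `p` identifies `T_p M` with the model space by the
identity. -/
theorem mfderiv_extChartAt_symm_self (p : M) :
    (mfderiv 𝓘(ℝ, E) I (extChartAt I p).symm (extChartAt I p p) : E →L[ℝ] E) =
      ContinuousLinearMap.id ℝ E := by
  have hm : MDifferentiableAt 𝓘(ℝ, E) I (extChartAt I p).symm (extChartAt I p p) := by
    have := mdifferentiableWithinAt_extChartAt_symm (I := I) (mem_extChartAt_target (I := I) p)
    rwa [I.range_eq_univ, mdifferentiableWithinAt_univ] at this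
  have hev : writtenInExtChartAt 𝓘(ℝ, E) I (extChartAt I p p) (extChartAt I p).symm
      =ᶠ[𝓝 (extChartAt I p p)] id := by
    filter_upwards [extChartAt_target_mem_nhds (I := I) p] with y hy
    change extChartAt I ((extChartAt I p).symm (extChartAt I p p)) ((extChartAt I p).symm y) = y
    rw [extChartAt_to_inv]
    exact (extChartAt I p).right_inv hy
  refine hm.mfderiv.trans ?_
  have hid : fderiv ℝ (id : E → E) (extChartAt I p p) = ContinuousLinearMap.id ℝ E := fderiv_id
  simp only [ModelWithCorners.range_eq_univ, fderivWithin_univ, extChartAt_model_space_eq_id,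
    PartialEquiv.refl_coe, id_eq]
  exact hev.fderiv_eq.trans hid

namespace SemiRiemannianMetric

open LocalGeometry

theorem chartExpression_self (g : SemiRiemannianMetric I M) (p : M) (u v : E) :
    chartExpression I g.val p (extChartAt I p p) u v = g.val p u v := by
  have key : ∀ q : M, q = p → ∀ u v : E, (show ℝ from g.val q u v) = g.val p u v := by
    rintro q rfl u v; rfl
  have hD := mfderiv_extChartAt_symm_self (I := I) p
  simp only [chartExpression, hD]
  exact key _ (extChartAt_to_inv p) u v

theorem isMetricAt_chartExpression [FiniteDimensional ℝ E] (g : SemiRiemannianMetric I M) (p : M) :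
    IsMetricAt (chartExpression I g.val p) (extChartAt I p p) where
  contDiffAt := by
    have h : ContDiffAt ℝ ∞ (chartExpression I g.val p) (extChartAt I p p) :=
      (g.smooth p).contDiffAt (extChartAt_target_mem_nhds p)
    exact h.of_le (by exact WithTop.coe_le_coe.2 (le_top : (2 : ℕ∞) ≤ ⊤))
  symm := Eventually.of_forall fun y u v => by
    simp only [chartExpression]
    exact g.symm ((extChartAt I p).symm y) _ _
  isInvertible := by
    refine isInvertible_of_nondegenerate fun u hu => ?_
    refine g.nondegenerate p u fun v => ?_
    exact (g.chartExpression_self p u v).symm.trans (hu v)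

theorem chartExpression_warpedProduct_eventuallyEq (gB : SemiRiemannianMetric I M) {f : M → ℝ}
    (hf : ContMDiff I 𝓘(ℝ, ℝ) ∞ f) (hf0 : ∀ q, 0 < f q) (gF : SemiRiemannianMetric I' N)
    (p : M × N) :
    chartExpression (I.prod I') (gB.warpedProduct f hf hf0 gF).val p
      =ᶠ[𝓝 (extChartAt (I.prod I') p p)]
      warpedMetric (chartExpression I gB.val p.1) (f ∘ (extChartAt I p.1).symm)
        (chartExpression I' gF.val p.2) := by
  filter_upwards [extChartAt_target_mem_nhds (I := I.prod I') p] with y hy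
    using chartExpression_warpedVal gB f gF p hy

theorem chartExpression_conformal_pseudoEuclidean {n : ℕ} {ε : Fin n → ℝ}
    (hε : ∀ i, ε i = 1 ∨ ε i = -1) {φ : EuclideanSpace ℝ (Fin n) → ℝ}
    (hφ : ContMDiff (𝓡 n) 𝓘(ℝ, ℝ) ∞ φ) (hφ0 : ∀ x, φ x ≠ 0) (p : EuclideanSpace ℝ (Fin n)) :
    chartExpression (𝓡 n) ((pseudoEuclidean ε hε).conformal φ hφ hφ0).val p =
      conformalMetric (fun _ => pseudoEuclideanForm ε) φ := by
  funext y
  have hD : (mfderiv (𝓡 n) (𝓡 n) (extChartAt (𝓡 n) p).symm y :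
      EuclideanSpace ℝ (Fin n) →L[ℝ] EuclideanSpace ℝ (Fin n)) =
      ContinuousLinearMap.id ℝ (EuclideanSpace ℝ (Fin n)) := by
    rw [extChartAt_model_space_eq_id]
    exact mfderiv_id
  simp only [chartExpression, hD]
  rfl

end SemiRiemannianMetric

end Charts

/-! ### The soliton equation -/

open LocalGeometry in
/-- The soliton equation of the warped product, tested on `(u, U)` and `(v, V)`, in the
given coordinates of the base: the block of the base and the block of the fibre add up. -/
theorem isGradientYamabeSoliton_warpedProduct_iff {n m : ℕ}
    {ε : Fin n → ℝ} (hε : ∀ i, ε i = 1 ∨ ε i = -1)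
    {F : Type*} [TopologicalSpace F] [ChartedSpace (EuclideanSpace ℝ (Fin m)) F]
    [IsManifold (𝓡 m) ∞ F] (gF : SemiRiemannianMetric (𝓡 m) F)
    {f φ h : EuclideanSpace ℝ (Fin n) → ℝ}
    (hf : ContMDiff (𝓡 n) 𝓘(ℝ, ℝ) ∞ f) (hφ : ContMDiff (𝓡 n) 𝓘(ℝ, ℝ) ∞ φ)
    (hh : ContMDiff (𝓡 n) 𝓘(ℝ, ℝ) ∞ h)
    (hf0 : ∀ x, 0 < f x) (hφ0 : ∀ x, φ x ≠ 0) (ρ : ℝ) :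
    (((pseudoEuclidean ε hε).conformal φ hφ hφ0).warpedProduct f hf hf0 gF).IsGradientYamabeSoliton
        (fun p : EuclideanSpace ℝ (Fin n) × F => h p.1) ρ ↔
      ∀ (x : EuclideanSpace ℝ (Fin n)) (y : F) (u v : EuclideanSpace ℝ (Fin n))
        (U V : TangentSpace (𝓡 m) y),
        (((n : ℝ) - 1) * (2 * φ x * ∑ k, ε k * partialDeriv k (partialDeriv k φ) x
              - n * ∑ k, ε k * partialDeriv k φ x ^ 2)
            + gF.scalarCurvature y / f x ^ 2
            - 2 * m / f x * (φ x ^ 2 * ∑ k, ε k * partialDeriv k (partialDeriv k f) x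
              - ((n : ℝ) - 2) * φ x * ∑ k, ε k * partialDeriv k φ x * partialDeriv k f x)
            - m * ((m : ℝ) - 1) / f x ^ 2 * φ x ^ 2 * ∑ k, ε k * partialDeriv k f x ^ 2
            - ρ) * ((φ x ^ 2)⁻¹ * pseudoEuclideanForm ε u v + f x ^ 2 * gF.val y U V) =
          hessian (conformalMetric (fun _ => pseudoEuclideanForm ε) φ) h x u v
            + f x * (φ x ^ 2 * ∑ k, ε k * partialDeriv k f x * partialDeriv k h x)
              * gF.val y U V := by
  have htwo : (2 : ℕ∞ω) ≤ ∞ := by exact WithTop.coe_le_coe.2 (le_top : (2 : ℕ∞) ≤ ⊤)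
  have cf : ∀ x, ContDiffAt ℝ 2 f x := fun x => (hf.contDiff.of_le htwo).contDiffAt
  have cφ : ∀ x, ContDiffAt ℝ 2 φ x := fun x => (hφ.contDiff.of_le htwo).contDiffAt
  have ch : ∀ x, ContDiffAt ℝ 2 h x := fun x => (hh.contDiff.of_le htwo).contDiffAt
  let W := ((pseudoEuclidean ε hε).conformal φ hφ hφ0).warpedProduct f hf hf0 gF
  let B := conformalMetric (fun _ => pseudoEuclideanForm ε) φ
  have hev : ∀ (x : EuclideanSpace ℝ (Fin n)) (y : F),
      chartExpression ((𝓡 n).prod (𝓡 m)) W.val (x, y) =ᶠ[nhds (x, extChartAt (𝓡 m) y y)]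
        warpedMetric B f (chartExpression (𝓡 m) gF.val y) := fun x y => by
    have h1 := SemiRiemannianMetric.chartExpression_warpedProduct_eventuallyEq
      ((pseudoEuclidean ε hε).conformal φ hφ hφ0) hf hf0 gF (x, y)
    rw [SemiRiemannianMetric.chartExpression_conformal_pseudoEuclidean] at h1
    exact h1
  have hS : ∀ x y, W.scalarCurvature (x, y) = _ := fun x y =>
    (scalarCurvature_congr (hev x y)).trans
      (scalarCurvature_warped_conformal_pseudoEuclidean hε (cφ x) (hφ0 x) (cf x) (hf0 x).ne'
        (gF.isMetricAt_chartExpression y))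
  have hH : ∀ x y (u v : EuclideanSpace ℝ (Fin n) × EuclideanSpace ℝ (Fin m)),
      W.hessian (fun p => h p.1) (x, y) u v = hessian B h x u.1 v.1
        + f x * (φ x ^ 2 * ∑ k, ε k * partialDeriv k f x * partialDeriv k h x)
          * gF.val y u.2 v.2 := fun x y u v => by
    have hg := isMetricAt_pseudoEuclideanForm hε x
    have h1 := hessian_warpedMetric (x := (x, extChartAt (𝓡 m) y y))
      (hg.conformalMetric (cφ x) (hφ0 x))
      (gF.isMetricAt_chartExpression y) (cf x) (hf0 x).ne' (ch x) u v
    rw [gradInner_conformalMetric hg (hφ0 x), gradInner_pseudoEuclideanForm hε,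
      gF.chartExpression_self] at h1
    rw [← h1]
    exact congr($(hessian_congr (hev x y) (fun p => h p.1)) u v)
  have hV : ∀ x y (u v : EuclideanSpace ℝ (Fin n) × EuclideanSpace ℝ (Fin m)),
      W.val (x, y) u v = (φ x ^ 2)⁻¹ * pseudoEuclideanForm ε u.1 v.1
        + f x ^ 2 * gF.val y u.2 v.2 := fun x y u v => rfl
  have hsm : ContMDiff ((𝓡 n).prod (𝓡 m)) 𝓘(ℝ, ℝ) ∞
      (fun p : EuclideanSpace ℝ (Fin n) × F => h p.1) := hh.comp contMDiff_fst
  rw [SemiRiemannianMetric.IsGradientYamabeSoliton, and_iff_right hsm]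
  simp only [finrank_euclideanSpace, Fintype.card_fin] at hS
  -- the tangent spaces of the product are `ℝⁿ × ℝᵐ` only up to unfolding, hence `erw`
  constructor
  · intro H x y u v U V
    have := H (x, y) (u, U) (v, V)
    erw [hS, hV, hH] at this
    exact this
  · rintro H ⟨x, y⟩ ⟨u, U⟩ ⟨v, V⟩
    erw [hS, hV, hH]
    exact H x y u v U V

theorem bilin_eq_of_single {n : ℕ}
    {b c : EuclideanSpace ℝ (Fin n) →L[ℝ] EuclideanSpace ℝ (Fin n) →L[ℝ] ℝ}
    (h : ∀ i j, b (EuclideanSpace.single j 1) (EuclideanSpace.single i 1) =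
      c (EuclideanSpace.single j 1) (EuclideanSpace.single i 1)) : b = c := by
  ext u v
  rw [LocalGeometry.apply_eq_sum_single (b u), LocalGeometry.apply_eq_sum_single (c u)]
  refine Finset.sum_congr rfl fun i _ => ?_
  have := LocalGeometry.apply_eq_sum_single (b.flip (EuclideanSpace.single i 1)) u
  have := LocalGeometry.apply_eq_sum_single (c.flip (EuclideanSpace.single i 1)) u
  simp_all

theorem exists_val_ne_zero {m : ℕ} (hm : 1 ≤ m) {F : Type*} [TopologicalSpace F]
    [ChartedSpace (EuclideanSpace ℝ (Fin m)) F] [IsManifold (𝓡 m) ∞ F]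
    (gF : SemiRiemannianMetric (𝓡 m) F) (y : F) :
    ∃ U V : TangentSpace (𝓡 m) y, gF.val y U V ≠ 0 := by
  by_contra! H
  have h1 : EuclideanSpace.single (⟨0, hm⟩ : Fin m) (1 : ℝ) = 0 :=
    gF.nondegenerate y (EuclideanSpace.single (⟨0, hm⟩ : Fin m) (1 : ℝ)) fun v => H _ v
  simpa using congr($h1 (⟨0, hm⟩ : Fin m))

open LocalGeometry in
theorem theorem1p3 {n m : ℕ} (hn : 3 ≤ n) (hm : 1 ≤ m)
    (ε : Fin n → ℝ) (hε : ∀ i, ε i = 1 ∨ ε i = -1)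
    {F : Type*} [TopologicalSpace F] [ChartedSpace (EuclideanSpace ℝ (Fin m)) F]
    [IsManifold (𝓡 m) ∞ F] [Nonempty F]
    (gF : SemiRiemannianMetric (𝓡 m) F) (lamF : ℝ) (hF : ∀ y, gF.scalarCurvature y = lamF)
    (f φ h : EuclideanSpace ℝ (Fin n) → ℝ)
    (hf : ContMDiff (𝓡 n) 𝓘(ℝ, ℝ) ∞ f) (hφ : ContMDiff (𝓡 n) 𝓘(ℝ, ℝ) ∞ φ)
    (hh : ContMDiff (𝓡 n) 𝓘(ℝ, ℝ) ∞ h)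
    (hf0 : ∀ x, 0 < f x) (hφ0 : ∀ x, φ x ≠ 0) (ρ : ℝ) :
    (((pseudoEuclidean ε hε).conformal φ hφ hφ0).warpedProduct f hf hf0 gF).IsGradientYamabeSoliton
        (fun p : EuclideanSpace ℝ (Fin n) × F => h p.1) ρ ↔
      (∀ x, ∀ i j, i ≠ j →
        partialDeriv j (partialDeriv i h) x + partialDeriv j φ x / φ x * partialDeriv i h x
          + partialDeriv i φ x / φ x * partialDeriv j h x = 0) ∧
      (∀ x, ∀ i,
        (((n : ℝ) - 1) * (2 * φ x * ∑ k, ε k * partialDeriv k (partialDeriv k φ) x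
              - n * ∑ k, ε k * partialDeriv k φ x ^ 2)
            + lamF / f x ^ 2
            - 2 * m / f x * (φ x ^ 2 * ∑ k, ε k * partialDeriv k (partialDeriv k f) x
              - ((n : ℝ) - 2) * φ x * ∑ k, ε k * partialDeriv k φ x * partialDeriv k f x)
            - m * ((m : ℝ) - 1) / f x ^ 2 * φ x ^ 2 * ∑ k, ε k * partialDeriv k f x ^ 2
            - ρ) * (ε i / φ x ^ 2) =
          partialDeriv i (partialDeriv i h) x + 2 * (partialDeriv i φ x / φ x) * partialDeriv i h x
            - ε i * ∑ k, ε k * (partialDeriv k φ x / φ x) * partialDeriv k h x) ∧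
      (∀ x,
        ((n : ℝ) - 1) * (2 * φ x * ∑ k, ε k * partialDeriv k (partialDeriv k φ) x
              - n * ∑ k, ε k * partialDeriv k φ x ^ 2)
            + lamF / f x ^ 2
            - 2 * m / f x * (φ x ^ 2 * ∑ k, ε k * partialDeriv k (partialDeriv k f) x
              - ((n : ℝ) - 2) * φ x * ∑ k, ε k * partialDeriv k φ x * partialDeriv k f x)
            - m * ((m : ℝ) - 1) / f x ^ 2 * φ x ^ 2 * ∑ k, ε k * partialDeriv k f x ^ 2
            - ρ =
          φ x ^ 2 / f x * ∑ k, ε k * partialDeriv k f x * partialDeriv k h x) := by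
  
  rw [isGradientYamabeSoliton_warpedProduct_iff hε gF hf hφ hh hf0 hφ0 ρ]
  simp only [hF]
  have htwo : (2 : ℕ∞ω) ≤ ∞ := by exact WithTop.coe_le_coe.2 (le_top : (2 : ℕ∞) ≤ ⊤)
  have cφ : ∀ x, ContDiffAt ℝ 2 φ x := fun x => (hφ.contDiff.of_le htwo).contDiffAt
  have ch : ∀ x, ContDiffAt ℝ 2 h x := fun x => (hh.contDiff.of_le htwo).contDiffAt
  have hval : ∀ i j, pseudoEuclideanForm ε (EuclideanSpace.single j 1)
      (EuclideanSpace.single i 1) = if i = j then ε i else 0 := fun i j => by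
    rw [pseudoEuclideanForm_apply]
    simp [PiLp.single_apply, eq_comm]
  have hhess := fun x i j =>
    hessian_conformal_pseudoEuclidean hε (cφ x) (hφ0 x) (ch x) i j
  constructor
  -- zero fibre vectors isolate the base equations, zero base vectors the fibre equation
  · intro H
    obtain ⟨y⟩ := ‹Nonempty F›
    refine ⟨fun x i j hij => ?_, fun x i => ?_, fun x => ?_⟩
    · have := H x y (EuclideanSpace.single j 1) (EuclideanSpace.single i 1) 0 0
      rw [hhess, hval, if_neg hij, if_neg hij, map_zero] at this
      linarith [this]
    · have := H x y (EuclideanSpace.single i 1) (EuclideanSpace.single i 1) 0 0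
      rw [hhess, hval, if_pos rfl, if_pos rfl, map_zero] at this
      rw [div_eq_inv_mul]
      linear_combination this
    · obtain ⟨U, V, hUV⟩ := exists_val_ne_zero hm gF y
      have := H x y 0 0 U V
      have h0 : hessian (conformalMetric (fun _ => pseudoEuclideanForm ε) φ) h x 0 0 = 0 := by
        simp [hessian]
      rw [h0, map_zero] at this
      have hfx := (hf0 x).ne'
      apply mul_right_cancel₀ (mul_ne_zero (pow_ne_zero 2 hfx) hUV)
      have hr : ∀ s : ℝ, φ x ^ 2 / f x * s * (f x ^ 2 * gF.val y U V) =
          f x * (φ x ^ 2 * s) * gF.val y U V := fun s => by field_simp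
      rw [hr]
      linear_combination this
  · rintro ⟨H1, H2, H3⟩ x y u v U V
    have hfx := (hf0 x).ne'
    -- by the fibre equation, `S - ρ` is this multiple of `⟨∇f, ∇h⟩` in the base equations, too
    rw [H3 x, mul_add]
    congr 1
    · rw [← mul_assoc]
      have key := bilin_eq_of_single 
        (b := (φ x ^ 2 / f x * (∑ k, ε k * partialDeriv k f x * partialDeriv k h x) *
          (φ x ^ 2)⁻¹) • pseudoEuclideanForm ε)
        (c := covDeriv (conformalMetric (fun _ => pseudoEuclideanForm ε) φ) (fderiv ℝ h) x)
        fun i j => ?_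
      · exact congr($key u v).trans (covDeriv_apply _ _ _ _ _)
      · refine Eq.trans ?_ ((hhess x i j).symm.trans (covDeriv_apply _ _ _ _ _).symm)
        rw [smul_apply, smul_apply, hval, smul_eq_mul]
        rcases eq_or_ne i j with rfl | hij
        · rw [if_pos rfl, if_pos rfl]
          have := H2 x i
          rw [H3 x, div_eq_inv_mul (ε i)] at this
          linear_combination this
        · rw [if_neg hij, if_neg hij]
          linarith [H1 x i j hij]
    · field_simp
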